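/- Let $\mathbb{D}$ be the open unit disc of $\mathbb{C}$ and $dA=dx\,dy/\pi$. Let $\omega:\mathbb{D}\to[0,\infty)$ be a radial weight, that is, $\omega$ is integrable with respect to $dA$ and $\omega(z)=\omega(|z|)$ for all $z\in\mathbb{D}$. Write $\widehat{\omega}(r)=\int_r^1\omega(s)\,ds$, and assume that $\omega\in\widehat{\mathcal{D}}$: $\widehat{\omega}(r)>0$ for all $0\le r<1$, and there is a finite constant $C$ with $\widehat{\omega}(r)\le C\,\widehat{\omega}\left(\frac{1+r}{2}\right)$ for all $0\le r<1$ (with $\widehat\omega$ finite; this follows from the inequality at $r=0$). Put $$\omega^\star(z)=\int_{|z|}^1\omega(s)\log\frac{s}{|z|}\,s\,ds,\qquad z\in\mathbb{D}\setminus\{0\},$$ and $\omega^\star(0)=+\infty$. Let $A^2_\omega$ be the Hilbert space of the analytic functions $f$ on $\mathbb{D}$ with $\|f\|^2_{A^2_\omega}=\int_{\mathbb{D}}|f|^2\omega\,dA<\infty$. For a bounded operator $T$ on a Hilbert space $H$ and $n\ge 0$ let $\lambda_n(T)=\inf\{\|T-R\|:R \text{ bounded},\ \operatorname{rank}R\le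 n\}$; for $0<p<\infty$ the Schatten class $\mathcal{S}_p(H)$ consists of the compact operators $T$ on $H$ with $\sum_{n=0}^\infty\lambda_n(T)^p<\infty$. Let $\varphi:\mathbb{D}\to\mathbb{D}$ be analytic, let $C_\varphi f=f\circ\varphi$, let $0<p<\infty$, and consider the condition $$\int_{\mathbb{D}}\left(\frac{\omega^\star(z)}{\omega^\star(\varphi(z))}\right)^{p/2}\frac{\omega(z)}{\omega^\star(z)}\,dA(z)<\infty.\qquad(*)$$ (a) If $0<p\le 2$ and $(*)$ holds, then $C_\varphi$ is a bounded operator on $A^2_\omega$ and $C_\varphi\in\mathcal{S}_p(A^2_\omega)$. (b) If $2\le p<\infty$ and $C_\varphi\in\mathcal{S}_p(A^2_\omega)$, then $(*)$ holds. -/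

import Mathlib

open MeasureTheory Set
open scoped ENNReal NNReal

noncomputable section

namespace WeightedBergman

/-- The open unit disc. -/
def disc : Set ℂ := Metric.ball 0 1

/-- The normalized area measure `dA = dx dy / π` on the unit disc. -/
def area : Measure ℂ := (ENNReal.ofReal Real.pi)⁻¹ • volume.restrict disc

/-- Radial weights: nonnegative functions on the disc, integrable with respect to area,
whose value at `z` depends on `|z|` only. -/
structure IsRadialWeight (ω : ℂ → ℝ) : Prop where
  nonneg : ∀ z ∈ disc, 0 ≤ ω z
  integrable : Integrable ω area
  radial : ∀ z ∈ disc, ω z = ω (‖z‖ : ℂ)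

/-- The tail `∫_r^1 ω(s) ds`, as an extended nonnegative number. -/
def tail (ω : ℂ → ℝ) (r : ℝ) : ℝ≥0∞ := ∫⁻ s in Ioo r 1, ENNReal.ofReal (ω (s : ℂ))

/-- The class of radial doubling weights: the tail is positive on `[0, 1)` and is at most a
constant times the tail from the point halfway to `1`. -/
structure IsDoubling (ω : ℂ → ℝ) : Prop where
  weight : IsRadialWeight ω
  tail_pos : ∀ r ∈ Ico (0 : ℝ) 1, 0 < tail ω r
  doubling : ∃ C : ℝ≥0, ∀ r ∈ Ico (0 : ℝ) 1, tail ω r ≤ C * tail ω ((1 + r) / 2)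

/-- The associated weight `∫_{|z|}^1 ω(s) log(s/|z|) s ds`, for `z ≠ 0` in the disc. At `z = 0`
this integral is `+∞` when the tails of `ω` are positive; Lean's value there is `0`, and a quotient
with this denominator is then `0` under either convention. -/
def star (ω : ℂ → ℝ) (z : ℂ) : ℝ := ∫ s in ‖z‖..1, ω (s : ℂ) * Real.log (s / ‖z‖) * s

/-- The measure `ω dA` on the disc. -/
def weightedArea (ω : ℂ → ℝ) : Measure ℂ := area.withDensity fun z => ENNReal.ofReal (ω z)

/-- The weighted Bergman space `A²_ω` with the norm and inner product of `L²(ω dA)`: the classes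
that are represented by a function analytic in the disc. For a weight with positive tails that
analytic representative is unique on the disc, by the identity theorem. -/
def bergmanSpace (ω : ℂ → ℝ) : Submodule ℂ (Lp ℂ 2 (weightedArea ω)) where
  carrier := {f | ∃ F : ℂ → ℂ, DifferentiableOn ℂ F disc ∧ f =ᵐ[weightedArea ω] F}
  zero_mem' := ⟨0, differentiableOn_const 0, Lp.coeFn_zero _ _ _⟩
  add_mem' := by
    rintro f g ⟨F, hF, hf⟩ ⟨G, hG, hg⟩
    exact ⟨F + G, hF.add hG, (Lp.coeFn_add f g).trans (hf.add hg)⟩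
  smul_mem' := by
    rintro c f ⟨F, hF, hf⟩
    exact ⟨c • F, hF.const_smul c, (Lp.coeFn_smul c f).trans (hf.const_smul c)⟩

section Schatten

variable {H : Type*} [NormedAddCommGroup H] [InnerProductSpace ℂ H]

/-- The `n`-th singular value: the distance of `T` from the bounded operators of rank at most `n`,
in operator norm. -/
def singularValue (T : H →L[ℂ] H) (n : ℕ) : ℝ :=
  sInf {d : ℝ | ∃ R : H →L[ℂ] H, LinearMap.rank (R : H →ₗ[ℂ] H) ≤ n ∧ d = ‖T - R‖}

/-- The Schatten class `S_p(H)`, for `0 < p < ∞`: the compact operators whose sequence of singular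
values is in `ℓ^p`. -/
def IsSchatten (p : ℝ) (T : H →L[ℂ] H) : Prop :=
  IsCompactOperator T ∧ Summable fun n : ℕ => singularValue T n ^ p

end Schatten

/-- `T` is the composition operator `f ↦ f ∘ φ` on `A²_ω`. -/
def IsCompositionOperator (ω : ℂ → ℝ) (φ : ℂ → ℂ)
    (T : bergmanSpace ω →L[ℂ] bergmanSpace ω) : Prop :=
  ∀ (f : bergmanSpace ω) (F : ℂ → ℂ), DifferentiableOn ℂ F disc →
    (f : Lp ℂ 2 (weightedArea ω)) =ᵐ[weightedArea ω] F →
    (T f : Lp ℂ 2 (weightedArea ω)) =ᵐ[weightedArea ω] F ∘ φ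

/-- `C_φ ∈ S_p(A²_ω)`: composition with `φ` is a bounded operator on `A²_ω`, of Schatten class. -/
def CompositionSchatten (p : ℝ) (ω : ℂ → ℝ) (φ : ℂ → ℂ) : Prop :=
  ∃ T : bergmanSpace ω →L[ℂ] bergmanSpace ω, IsCompositionOperator ω φ T ∧ IsSchatten p T

/-- The integral `∫_𝔻 (ω⋆(z) / ω⋆(φ(z)))^{p/2} (ω(z) / ω⋆(z)) dA(z)`, in `[0, ∞]`. -/
def compositionIntegral (p : ℝ) (ω : ℂ → ℝ) (φ : ℂ → ℂ) : ℝ≥0∞ :=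
  ∫⁻ z, ENNReal.ofReal ((star ω z / star ω (φ z)) ^ (p / 2) * (ω z / star ω z)) ∂area

end WeightedBergman

end

/-! Let `K z` be the reproducing kernel of A²_ω at z. A bounded `C_φ` satisfies C_φ* K_z = K_{φ(z)},
so the singular values can be read off from ‖K_z‖ and ‖K_{φ(z)}‖. Diagonalise T T* with orthonormal
eigenvectors e_i and positive eigenvalues l_i, the squares of the singular values. Then ‖T* K_z‖² =
Σ l_i |e_i(z)|² and Σ |e_i(z)|² ≤ ‖K_z‖², while ∫ |e_i|² ω dA = 1 gives Σ l_i^{p/2} = ∫ Σ l_i^{p/2}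
|e_i(z)|² ω dA. Jensen's inequality with the weights |e_i(z)|² bounds the inner sum above by
‖K_z‖^{2-p} ‖T* K_z‖^p when p ≤ 2, and below by the same quantity when p ≥ 2
(`isSchatten_of_kernel`, `IsSchatten.exists_kernel_bound`).

It remains to see that ‖K_z‖² is comparable to 1/ω⋆(z). Both are of order 1/((1-|z|) ω̂(|z|)) near
the boundary: the upper bound for the kernel is point evaluation, the lower bound comes from a test
polynomial (`exists_le_kernel_norm_sq_of_half_le`), and doubling makes the tails match.

The comparison fails at the origin, where 1/ω⋆ vanishes and the kernel does not. In (b) this costs a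
power of log(1/|z|), which is dominated by the integrable function 1/|z|. In (a) the kernels
K_{φ(z)} are replaced by K_{φ(z)} - K_0, whose squared norm is at most a constant over ω⋆(φ(z))
throughout (`exists_kernel_sub_norm_sq_mul_star_le`); they represent f ↦ f∘φ - f(0), a rank one
perturbation of `C_φ`. Schwarz–Pick gives ω⋆(z) ≤ C ω⋆(φ(z)) away from the origin, so (*) for p ≤ 2
also controls the Hilbert–Schmidt integral, hence boundedness and compactness. -/

namespace WeightedBergman

/-! ### Singular values and the spectral theorem for compact operators -/

section Operators

open Module.End ContinuousLinearMap

universe u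

variable {H : Type u} [NormedAddCommGroup H] [InnerProductSpace ℂ H]

theorem inner_self_eq_ofReal (x : H) : inner ℂ x x = ((‖x‖ ^ 2 : ℝ) : ℂ) := by
  rw [inner_self_eq_norm_sq_to_K]
  simp

/-- Hilbert bases of the eigenspaces are glued together; eigenspaces are mutually orthogonal and, by
the spectral theorem, jointly total. -/
theorem exists_hilbertBasis_eigenvectors [CompleteSpace H] (A : H →L[ℂ] H)
    (hA : IsCompactOperator A) (hs : A.IsSymmetric) :
    ∃ (ι : Type u) (b : HilbertBasis ι ℂ H) (m : ι → ℂ), ∀ i, A (b i) = m i • b i := by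
  have hcl : ∀ μ : ℂ, IsClosed (eigenspace (A : Module.End ℂ H) μ : Set H) := by
    intro μ
    have : (eigenspace (A : Module.End ℂ H) μ : Set H) = {x | A x = μ • x} := by
      ext x; simp
    rw [this]
    exact isClosed_eq A.continuous (continuous_const_smul μ)
  have hcomp : ∀ μ : ℂ, CompleteSpace (eigenspace (A : Module.End ℂ H) μ) :=
    fun μ => (hcl μ).completeSpace_coe
  choose w b hb using fun μ : ℂ => exists_hilbertBasis ℂ (eigenspace (A : Module.End ℂ H) μ)
  have hV := hs.orthogonalFamily_eigenspaces
  have hv := hV.orthonormal_sigma_orthonormal fun μ => (b μ).orthonormal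
  -- A vector orthogonal to the chosen basis of an eigenspace is, by continuity, orthogonal to the
  -- whole eigenspace.
  have hbot : (Submodule.span ℂ (Set.range fun a : Σ μ, w μ =>
      (eigenspace (A : Module.End ℂ H) a.1).subtypeₗᵢ (b a.1 a.2)))ᗮ = ⊥ := by
    rw [eq_bot_iff, ← orthogonalComplement_iSup_eigenspaces_eq_bot hA hs,
      ← Submodule.iInf_orthogonal]
    intro x hx
    rw [Submodule.mem_iInf]
    intro μ
    rw [Submodule.mem_orthogonal]
    intro y hy
    have hcl' : IsClosed {z : eigenspace (A : Module.End ℂ H) μ | inner ℂ (z : H) x = 0} :=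
      isClosed_eq (by fun_prop) continuous_const
    have hsub : ((Submodule.span ℂ (Set.range (b μ))).topologicalClosure : Set _) ⊆
        {z : eigenspace (A : Module.End ℂ H) μ | inner ℂ (z : H) x = 0} := by
      refine closure_minimal (fun z hz => ?_) hcl'
      induction hz using Submodule.span_induction with
      | mem z hz =>
        obtain ⟨i, rfl⟩ := hz
        exact (Submodule.mem_orthogonal _ _).1 hx _ (Submodule.subset_span ⟨⟨μ, i⟩, rfl⟩)
      | zero => simp
      | add z w _ _ hz hw =>
        simp only [Set.mem_ofPred_eq] at hz hw
        simp [hz, hw]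
      | smul c z _ hz =>
        simp only [Set.mem_ofPred_eq] at hz
        simp [hz]
    rw [(b μ).dense_span] at hsub
    exact hsub (Set.mem_univ (⟨y, hy⟩ : eigenspace (A : Module.End ℂ H) μ))
  refine ⟨_, HilbertBasis.mkOfOrthogonalEqBot hv hbot, fun a => a.1, fun a => ?_⟩
  rw [HilbertBasis.coe_mkOfOrthogonalEqBot]
  exact mem_eigenspace_iff.1 (b a.1 a.2).2

/-- The eigenvectors of `T T†` for its nonzero eigenvalues. -/
theorem exists_spectral_family [CompleteSpace H] (T : H →L[ℂ] H) (hT : IsCompactOperator T) :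
    ∃ (ι : Type u) (e : ι → H) (l : ι → ℝ), Orthonormal ℂ e ∧ (∀ i, 0 < l i) ∧
      (∀ i, T (adjoint T (e i)) = (l i : ℂ) • e i) ∧
      ∀ x, HasSum (fun i => l i * ‖inner ℂ (e i) x‖ ^ 2) (‖adjoint T x‖ ^ 2) := by
  have hself : IsSelfAdjoint (T ∘L adjoint T) := by
    rw [ContinuousLinearMap.isSelfAdjoint_iff', adjoint_comp, adjoint_adjoint]
  obtain ⟨ι, b, m, hm⟩ := exists_hilbertBasis_eigenvectors (T ∘L adjoint T)
    (hT.comp_clm (adjoint T)) hself.isSymmetric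
  have hinner : ∀ i, m i = ((‖adjoint T (b i)‖ ^ 2 : ℝ) : ℂ) := by
    intro i
    have h1 : inner ℂ (b i) (T (adjoint T (b i))) = m i := by
      have := hm i
      simp only [comp_apply] at this
      rw [this, inner_smul_right, inner_self_eq_ofReal, b.orthonormal.1 i]
      simp
    rw [← h1, ← adjoint_inner_left, inner_self_eq_ofReal]
  set l : ι → ℝ := fun i => ‖adjoint T (b i)‖ ^ 2 with hl
  have hsum : ∀ x, HasSum (fun i => l i * ‖inner ℂ (b i) x‖ ^ 2) (‖adjoint T x‖ ^ 2) := by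
    intro x
    have h := b.hasSum_inner_mul_inner (T (adjoint T x)) x
    rw [← adjoint_inner_right, inner_self_eq_ofReal] at h
    have h2 : ∀ i, inner ℂ (T (adjoint T x)) (b i) * inner ℂ (b i) x
        = ((l i * ‖inner ℂ (b i) x‖ ^ 2 : ℝ) : ℂ) := by
      intro i
      have h3 : inner ℂ (T (adjoint T x)) (b i) = inner ℂ x (T (adjoint T (b i))) := by
        rw [← adjoint_inner_right, adjoint_inner_left]
      have := hm i
      simp only [comp_apply] at this
      rw [h3, this, inner_smul_right, hinner, mul_assoc, ← inner_conj_symm x (b i),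
        Complex.conj_mul']
      simp only [hl]
      push_cast
      ring
    simp_rw [h2] at h
    exact Complex.hasSum_ofReal.1 h
  -- Zero eigenvalues contribute nothing to the series. With them removed, summability of `l i ^ (p
  -- / 2)` will force the index type to be countable.
  refine ⟨{i // l i ≠ 0}, fun i => b i, fun i => l i, b.orthonormal.comp _ Subtype.val_injective,
    fun i => lt_of_le_of_ne (by positivity) i.2.symm, fun i => ?_, fun x => ?_⟩
  · have := hm i
    rw [hinner] at this
    exact this
  · have := hsum x
    rw [← hasSum_subtype_iff_of_support_subset (s := {i | l i ≠ 0})] at this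
    · exact this
    · intro i hi h0
      simp [h0] at hi

theorem singularValue_le (T R : H →L[ℂ] H) {n : ℕ}
    (hR : LinearMap.rank (R : H →ₗ[ℂ] H) ≤ n) : singularValue T n ≤ ‖T - R‖ :=
  csInf_le ⟨0, by rintro _ ⟨R, -, rfl⟩; positivity⟩ ⟨R, hR, rfl⟩

theorem singularValue_nonneg (T : H →L[ℂ] H) (n : ℕ) : 0 ≤ singularValue T n :=
  Real.sInf_nonneg (by rintro _ ⟨R, -, rfl⟩; positivity)

theorem le_singularValue (T : H →L[ℂ] H) {n : ℕ} {c : ℝ}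
    (h : ∀ R : H →L[ℂ] H, LinearMap.rank (R : H →ₗ[ℂ] H) ≤ n → c ≤ ‖T - R‖) :
    c ≤ singularValue T n :=
  le_csInf ⟨_, 0, by simp, rfl⟩ (by rintro _ ⟨R, hR, rfl⟩; exact h R hR)

theorem hasOrthogonalProjection_span_image {ι : Type*} (e : ι → H) (F : Finset ι) :
    (Submodule.span ℂ (e '' F)).HasOrthogonalProjection := by
  have := FiniteDimensional.span_of_finite ℂ (F.finite_toSet.image e)
  infer_instance

attribute [local instance] hasOrthogonalProjection_span_image

/-- The rank of the projection onto the span of a finite family. -/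
theorem rank_starProjection_comp_le {ι : Type*} (e : ι → H) (F : Finset ι) (T : H →L[ℂ] H) :
    LinearMap.rank (((Submodule.span ℂ (e '' F)).starProjection ∘L T : H →L[ℂ] H) : H →ₗ[ℂ] H)
      ≤ F.card := by
  classical
  set K := Submodule.span ℂ (e '' F)
  refine (LinearMap.rank_comp_le_left _ _).trans ?_
  calc Module.rank ℂ (LinearMap.range (K.starProjection : H →ₗ[ℂ] H)) ≤ Module.rank ℂ K := by
        apply Submodule.rank_mono
        rintro _ ⟨x, rfl⟩
        exact Submodule.starProjection_apply_mem K x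
    _ ≤ (F.image e).card := by
        have : K = Submodule.span ℂ ((F.image e : Finset H) : Set H) := by simp [K]
        rw [this]
        exact rank_span_finset_le _
    _ ≤ F.card := by exact_mod_cast Finset.card_image_le

theorem norm_sub_starProjection_le (K : Submodule ℂ H) [K.HasOrthogonalProjection] (x : H) :
    ‖x - K.starProjection x‖ ≤ ‖x‖ := by
  rw [← Submodule.starProjection_orthogonal_val]
  exact Submodule.norm_starProjection_apply_le _ x

/-- The approximant is P T with P the projection onto the span of the `e i`, `i ∈ F`. The adjoint of
T - P T is T†(1 - P), and the spectral series of a vector in the range of 1 - P involves only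
indices outside `F`. -/
theorem singularValue_le_of_notMem [CompleteSpace H] {ι : Type*} {T : H →L[ℂ] H} {e : ι → H}
    {l : ι → ℝ} (he : Orthonormal ℂ e)
    (hsum : ∀ x, HasSum (fun i => l i * ‖inner ℂ (e i) x‖ ^ 2) (‖adjoint T x‖ ^ 2))
    (F : Finset ι) {n : ℕ} (hF : F.card ≤ n) {c : ℝ} (hc : 0 ≤ c) (hl : ∀ i ∉ F, l i ≤ c ^ 2) :
    singularValue T n ≤ c := by
  set K := Submodule.span ℂ (e '' F)
  refine (singularValue_le T (K.starProjection ∘L T)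
    ((rank_starProjection_comp_le e F T).trans (by exact_mod_cast hF))).trans ?_
  have h1 : T - K.starProjection ∘L T = (1 - K.starProjection) ∘L T := by
    ext x; simp
  have h2 : adjoint (T - K.starProjection ∘L T) = adjoint T ∘L (1 - K.starProjection) := by
    rw [h1, adjoint_comp, map_sub]
    congr 2
    · exact (IsSelfAdjoint.one (H →L[ℂ] H)).star_eq
    · exact (isSelfAdjoint_starProjection K).star_eq
  rw [← LinearIsometryEquiv.norm_map adjoint, h2]
  refine opNorm_le_bound _ hc fun x => ?_
  set y := x - K.starProjection x with hy
  have hyx : ‖y‖ ≤ ‖x‖ := norm_sub_starProjection_le K x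
  have hF0 : ∀ i ∈ F, inner ℂ (e i) y = 0 := fun i hi =>
    Submodule.sub_starProjection_mem_orthogonal x (e i) (Submodule.subset_span ⟨i, hi, rfl⟩)
  have hle : ‖adjoint T y‖ ^ 2 ≤ (c * ‖y‖) ^ 2 := by
    rw [mul_pow]
    refine (hasSum_le (fun i => ?_) (hsum y)
      ((he.inner_products_summable y).hasSum.mul_left (c ^ 2))).trans
      (mul_le_mul_of_nonneg_left (he.tsum_inner_products_le y) (sq_nonneg c))
    by_cases hi : i ∈ F
    · simp [hF0 i hi]
    · exact mul_le_mul_of_nonneg_right (hl i hi) (sq_nonneg _)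
  have := abs_le_of_sq_le_sq' hle (by positivity) |>.2
  simpa [hy] using this.trans (mul_le_mul_of_nonneg_left hyx hc)

/-- The index type carries no decreasing enumeration of the eigenvalues, so indices are chosen
greedily: each nonzero singular value is charged to a fresh index whose eigenvalue exceeds a quarter
of its square. The lost factor 2 becomes `2 ^ p`. -/
theorem summable_singularValue_rpow [CompleteSpace H] {ι : Type*} {T : H →L[ℂ] H} {e : ι → H}
    {l : ι → ℝ} (he : Orthonormal ℂ e)
    (hsum : ∀ x, HasSum (fun i => l i * ‖inner ℂ (e i) x‖ ^ 2) (‖adjoint T x‖ ^ 2))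
    {p : ℝ} (hp : 0 < p) {M : ℝ} (hM : ∀ F : Finset ι, ∑ i ∈ F, l i ^ (p / 2) ≤ M) :
    Summable fun n => singularValue T n ^ p := by
  classical
  have key : ∀ N : ℕ, ∃ F : Finset ι, F.card ≤ N ∧
      ∑ n ∈ Finset.range N, singularValue T n ^ p ≤ 2 ^ p * ∑ i ∈ F, l i ^ (p / 2) := by
    intro N
    induction N with
    | zero => exact ⟨∅, by simp⟩
    | succ N ih =>
      obtain ⟨F, hF, hs⟩ := ih
      rw [Finset.sum_range_succ]
      rcases (singularValue_nonneg T N).eq_or_lt with h0 | h0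
      · exact ⟨F, by omega, by simpa [← h0, Real.zero_rpow hp.ne'] using hs⟩
      -- Otherwise the singular value would be at most half of itself.
      · obtain ⟨i, hi, hli⟩ : ∃ i ∉ F, (singularValue T N / 2) ^ 2 < l i := by
          by_contra! hcon
          have := singularValue_le_of_notMem he hsum F hF (by positivity) hcon
          linarith
        refine ⟨insert i F, (Finset.card_insert_le _ _).trans (by omega), ?_⟩
        rw [Finset.sum_insert hi, mul_add, add_comm]
        refine add_le_add ?_ hs
        calc singularValue T N ^ p = 2 ^ p * ((singularValue T N / 2) ^ 2) ^ (p / 2) := by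
              rw [← Real.rpow_natCast, ← Real.rpow_mul (by positivity), Nat.cast_ofNat,
                mul_div_cancel₀ p two_ne_zero, ← Real.mul_rpow (by positivity) (by positivity),
                mul_div_cancel₀ _ two_ne_zero]
          _ ≤ _ := by gcongr
  refine summable_of_sum_range_le (c := 2 ^ p * M)
    (fun n => Real.rpow_nonneg (singularValue_nonneg T n) p) fun N => ?_
  obtain ⟨F, -, hs⟩ := key N
  exact hs.trans (by gcongr; exact hM F)

/-- An operator of rank at most n kills some nontrivial combination of the more than n vectors T†
e_i. On their span T expands norms by at least c, so T - R does so on that combination. -/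
theorem exists_sqrt_le_singularValue [CompleteSpace H] {ι : Type*} {T : H →L[ℂ] H} {e : ι → H}
    {l : ι → ℝ} (he : Orthonormal ℂ e) (hl : ∀ i, 0 < l i)
    (heig : ∀ i, T (adjoint T (e i)) = (l i : ℂ) • e i)
    (F : Finset ι) {n : ℕ} (hF : n < F.card) {c : ℝ} (hcl : ∀ i ∈ F, c ^ 2 ≤ l i) :
    c ≤ singularValue T n := by
  refine le_singularValue T fun R hR => ?_
  set Φ : (F → ℂ) →ₗ[ℂ] H := Fintype.linearCombination ℂ (fun i : F => adjoint T (e i)) with hΦ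
  obtain ⟨a, ha, ha0⟩ : ∃ a : F → ℂ, R (Φ a) = 0 ∧ a ≠ 0 := by
    by_contra! hcon
    have hinj : Function.Injective ((R : H →ₗ[ℂ] H) ∘ₗ Φ) := by
      rw [← LinearMap.ker_eq_bot, LinearMap.ker_eq_bot']
      exact fun a h => hcon a h
    have h2 := (LinearMap.rank_comp_le_left Φ (R : H →ₗ[ℂ] H)).trans hR
    rw [LinearMap.rank, rank_eq_card_basis ((Pi.basisFun ℂ F).map
      (LinearEquiv.ofInjective _ hinj))] at h2
    simp only [Fintype.card_coe, Nat.cast_le] at h2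
    omega
  set v : H := ∑ i : F, a i • e i with hv
  have hTv : adjoint T v = Φ a := by
    simp [hv, hΦ, Fintype.linearCombination_apply]
  have hTTv : T (Φ a) = ∑ i : F, (a i * l i) • e i := by
    simp [hΦ, Fintype.linearCombination_apply, heig, mul_smul]
  have heF : Orthonormal ℂ (fun i : F => e i) := he.comp _ Subtype.val_injective
  have hnorm : ∀ c : F → ℂ, ‖∑ i : F, c i • e i‖ ^ 2 = ∑ i : F, ‖c i‖ ^ 2 := by
    intro c
    have h := heF.inner_sum c c Finset.univ
    rw [inner_self_eq_ofReal] at h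
    simp_rw [Complex.conj_mul'] at h
    exact_mod_cast h
  have hn1 : ‖T (Φ a)‖ ^ 2 = ∑ i : F, ‖a i‖ ^ 2 * (l i) ^ 2 := by
    rw [hTTv, hnorm]
    simp [mul_pow]
  have hn2 : ‖Φ a‖ ^ 2 = ∑ i : F, ‖a i‖ ^ 2 * l i := by
    have h : inner ℂ v (T (Φ a)) = ((‖Φ a‖ ^ 2 : ℝ) : ℂ) := by
      rw [← adjoint_inner_left, hTv, inner_self_eq_ofReal]
    rw [hTTv, hv, heF.inner_sum] at h
    rw [← Complex.ofReal_inj, ← h]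
    push_cast
    refine Finset.sum_congr rfl fun i _ => ?_
    rw [← mul_assoc, Complex.conj_mul']
  have hpos : 0 < ‖Φ a‖ ^ 2 := by
    rw [hn2]
    obtain ⟨i, hi⟩ := Function.ne_iff.1 ha0
    refine Finset.sum_pos' (fun j _ => mul_nonneg (sq_nonneg _) (hl j).le) ⟨i, Finset.mem_univ _, ?_⟩
    have : 0 < ‖a i‖ := norm_pos_iff.2 hi
    have := hl i
    positivity
  have hle : (c * ‖Φ a‖) ^ 2 ≤ ‖T (Φ a)‖ ^ 2 := by
    rw [mul_pow, hn1, hn2, Finset.mul_sum]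
    refine Finset.sum_le_sum fun i _ => ?_
    have := mul_le_mul_of_nonneg_left (mul_le_mul_of_nonneg_right (hcl i i.2) (hl i).le)
      (sq_nonneg ‖a i‖)
    nlinarith
  have hle' := (abs_le_of_sq_le_sq' hle (norm_nonneg _)).2
  have h3 : ‖T (Φ a)‖ ≤ ‖T - R‖ * ‖Φ a‖ := by
    have := (T - R).le_opNorm (Φ a)
    simpa [ha] using this
  have h4 : 0 < ‖Φ a‖ := by
    by_contra h
    have : ‖Φ a‖ = 0 := le_antisymm (not_lt.1 h) (norm_nonneg _)
    simp [this] at hpos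
  exact le_of_mul_le_mul_right (hle'.trans h3) h4

/-- Induction removing the smallest eigenvalue of `F`: if `F` has n + 1 elements, that eigenvalue is
at most the square of the n-th singular value. -/
theorem sum_rpow_le_sum_singularValue [CompleteSpace H] {ι : Type*} {T : H →L[ℂ] H} {e : ι → H}
    {l : ι → ℝ} (he : Orthonormal ℂ e) (hl : ∀ i, 0 < l i)
    (heig : ∀ i, T (adjoint T (e i)) = (l i : ℂ) • e i) {p : ℝ} (hp : 0 < p) (F : Finset ι) :
    ∑ i ∈ F, l i ^ (p / 2) ≤ ∑ n ∈ Finset.range F.card, singularValue T n ^ p := by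
  classical
  induction hn : F.card generalizing F with
  | zero => simp [Finset.card_eq_zero.1 hn]
  | succ n ih =>
    obtain ⟨i, hi, hmin⟩ := F.exists_min_image l (Finset.card_pos.1 (by omega))
    rw [← Finset.sum_erase_add _ _ hi, Finset.sum_range_succ]
    refine add_le_add (ih _ (by rw [Finset.card_erase_of_mem hi]; omega)) ?_
    have h := exists_sqrt_le_singularValue he hl heig F (n := n) (by omega) (c := √(l i))
      (by simpa [Real.sq_sqrt (hl i).le] using hmin)
    calc l i ^ (p / 2) = √(l i) ^ p := by
          rw [Real.sqrt_eq_rpow, ← Real.rpow_mul (hl i).le]; ring_nf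
      _ ≤ _ := by gcongr

theorem isCompactOperator_of_rank_le {R : H →L[ℂ] H} {n : ℕ}
    (hR : LinearMap.rank (R : H →ₗ[ℂ] H) ≤ n) : IsCompactOperator R := by
  have : FiniteDimensional ℂ (LinearMap.range (R : H →ₗ[ℂ] H)) :=
    Module.rank_lt_aleph0_iff.1 (hR.trans_lt (Cardinal.natCast_lt_aleph0))
  have : LocallyCompactSpace (LinearMap.range (R : H →ₗ[ℂ] H)) :=
    have := FiniteDimensional.proper ℂ (LinearMap.range (R : H →ₗ[ℂ] H))
    inferInstance
  exact (isCompactOperator_of_locallyCompactSpace_rng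
    (LinearMap.range (R : H →ₗ[ℂ] H)).subtypeL).comp_clm
      (R.codRestrict (LinearMap.range (R : H →ₗ[ℂ] H)) fun x => ⟨x, rfl⟩)

/-- Hilbert--Schmidt operators are compact. -/
theorem isCompactOperator_of_sum_norm_sq_le [CompleteSpace H] {T : H →L[ℂ] H} {M : ℝ}
    (hM : ∀ s : Finset H, (∀ x ∈ s, ‖x‖ = 1) → (∀ x ∈ s, ∀ y ∈ s, x ≠ y → inner ℂ x y = 0) →
      ∑ x ∈ s, ‖T x‖ ^ 2 ≤ M) :
    IsCompactOperator T := by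
  classical
  set S : Set ℝ := {d | ∃ s : Finset H, (∀ x ∈ s, ‖x‖ = 1) ∧
    (∀ x ∈ s, ∀ y ∈ s, x ≠ y → inner ℂ x y = 0) ∧ d = ∑ x ∈ s, ‖T x‖ ^ 2}
  have hbdd : BddAbove S := ⟨M, by rintro _ ⟨s, h1, h2, rfl⟩; exact hM s h1 h2⟩
  have hne : S.Nonempty := ⟨0, ∅, by simp⟩
  have key : ∀ ε > 0, ∃ R : H →L[ℂ] H, IsCompactOperator R ∧ ‖T - R‖ ≤ ε := by
    intro ε hε
    -- A finite orthonormal set `s` whose sum is within ε² of the supremum. Adjoining a unit vector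
    -- y orthogonal to `s` cannot pass the supremum, so ‖T y‖ ≤ ε; hence T is within ε of a finite
    -- rank operator.
    obtain ⟨_, ⟨s, h1, h2, rfl⟩, hs⟩ := exists_lt_of_lt_csSup hne
      (show sSup S - ε ^ 2 < sSup S by linarith [pow_pos hε 2])
    have hunit : ∀ y : H, ‖y‖ = 1 → (∀ x ∈ s, inner ℂ x y = 0) → ‖T y‖ ≤ ε := by
      intro y hy hxy
      have hys : y ∉ s := fun h => by
        have := hxy y h
        rw [inner_self_eq_zero] at this
        simp [this] at hy
      have := le_csSup hbdd (a := ∑ x ∈ insert y s, ‖T x‖ ^ 2) ⟨insert y s, by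
        simpa [hy] using h1, by
        intro x hx z hz hxz
        rw [Finset.mem_insert] at hx hz
        rcases hx with rfl | hx <;> rcases hz with rfl | hz
        · exact absurd rfl hxz
        · rw [← inner_conj_symm, hxy z hz, map_zero]
        · exact hxy x hx
        · exact h2 x hx z hz hxz, rfl⟩
      rw [Finset.sum_insert hys] at this
      exact (abs_le_of_sq_le_sq' (by linarith) hε.le).2
    set P := (Submodule.span ℂ (id '' (s : Set H))).starProjection with hP
    have hrank : LinearMap.rank (P : H →ₗ[ℂ] H) ≤ s.card := by
      have := rank_starProjection_comp_le id s (ContinuousLinearMap.id ℂ H)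
      rwa [comp_id] at this
    refine ⟨T ∘L P, (isCompactOperator_of_rank_le hrank).clm_comp T, ?_⟩
    refine opNorm_le_bound _ hε.le fun x => ?_
    set y := x - P x with hy
    have hyx : ‖y‖ ≤ ‖x‖ := norm_sub_starProjection_le _ x
    have hTy : ‖T y‖ ≤ ε * ‖y‖ := by
      rcases eq_or_ne y 0 with h0 | h0
      · simp [h0]
      have hy0 : 0 < ‖y‖ := norm_pos_iff.2 h0
      have := hunit ((‖y‖⁻¹ : ℂ) • y) (by simp [norm_smul, hy0.ne']) fun z hz => by
        have h0 : inner ℂ z y = 0 := Submodule.sub_starProjection_mem_orthogonal x z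
          (Submodule.subset_span ⟨z, hz, rfl⟩)
        rw [inner_smul_right, h0, mul_zero]
      rw [map_smul, norm_smul, norm_inv, Complex.norm_real, norm_norm, inv_mul_le_iff₀ hy0] at this
      linarith
    have : (T - T ∘L P) x = T y := by simp [hy]
    rw [this]
    exact hTy.trans (by gcongr)
  choose R hR hTR using fun n : ℕ => key (1 / (n + 1 : ℝ)) (by positivity)
  refine isCompactOperator_of_tendsto (l := Filter.atTop) (F := R) ?_ (.of_forall hR)
  rw [tendsto_iff_norm_sub_tendsto_zero]
  refine squeeze_zero (fun _ => norm_nonneg _) (fun n => ?_) tendsto_one_div_add_atTop_nhds_zero_nat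
  rw [norm_sub_rev]
  exact hTR n

/-- A rank one perturbation shifts the sequence by one place: s_{n+1}(T + R) ≤ s_n(T). -/
theorem IsSchatten.add_of_rank_le_one {p : ℝ} (hp : 0 < p) {T R : H →L[ℂ] H}
    (hT : IsSchatten p T) (hR : LinearMap.rank (R : H →ₗ[ℂ] H) ≤ 1) : IsSchatten p (T + R) := by
  refine ⟨hT.1.add (isCompactOperator_of_rank_le (n := 1) (by simpa using hR)), ?_⟩
  rw [← summable_nat_add_iff 1]
  refine Summable.of_nonneg_of_le (fun n => Real.rpow_nonneg (singularValue_nonneg _ _) _)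
    (fun n => ?_) hT.2
  refine Real.rpow_le_rpow (singularValue_nonneg _ _) ?_ hp.le
  refine le_singularValue T fun S hS => ?_
  have : T - S = (T + R) - (S + R) := by abel
  rw [this]
  refine singularValue_le _ _ ?_
  have := (LinearMap.rank_add_le (S : H →ₗ[ℂ] H) R).trans (add_le_add hS hR)
  simpa using this

end Operators

end WeightedBergman

namespace WeightedBergman

/-! ### Polar coordinates on the disc -/

section Polar

theorem measurableSet_disc : MeasurableSet disc := Metric.isOpen_ball.measurableSet

theorem isOpen_disc : IsOpen disc := Metric.isOpen_ball

theorem mem_disc {z : ℂ} : z ∈ disc ↔ ‖z‖ < 1 := by simp [disc]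

theorem norm_circleMap_of_pos {s : ℝ} (hs : 0 < s) (θ : ℝ) : ‖circleMap 0 s θ‖ = s := by
  simp [circleMap, abs_of_pos hs]

theorem measurable_circleMap_prod : Measurable fun q : ℝ × ℝ => circleMap 0 q.1 q.2 := by
  unfold circleMap
  fun_prop

/-- Integration over the disc in polar coordinates. -/
theorem lintegral_area_of_measurable {g : ℂ → ℝ≥0∞} (hg : Measurable g) :
    ∫⁻ z, g z ∂area = (ENNReal.ofReal Real.pi)⁻¹ * ∫⁻ s in Ioo (0 : ℝ) 1,
      ENNReal.ofReal s * ∫⁻ θ in Ioo (-Real.pi) Real.pi, g (circleMap 0 s θ) := by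
  have h1 : ∀ p : ℝ × ℝ, Complex.polarCoord.symm p = circleMap 0 p.1 p.2 := by
    intro p
    rw [Complex.polarCoord_symm_apply, circleMap, Complex.exp_mul_I]
    simp
  rw [area, lintegral_smul_measure, smul_eq_mul, ← lintegral_indicator measurableSet_disc,
    ← Complex.lintegral_comp_polarCoord_symm]
  congr 1
  simp_rw [h1, polarCoord_target, smul_eq_mul]
  rw [Measure.volume_eq_prod, ← Measure.prod_restrict, lintegral_prod _ (by
    refine Measurable.aemeasurable ?_
    exact (by fun_prop : Measurable fun p : ℝ × ℝ => ENNReal.ofReal p.1).mul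
      ((hg.indicator measurableSet_disc).comp measurable_circleMap_prod))]
  rw [← lintegral_indicator measurableSet_Ioi, ← lintegral_indicator measurableSet_Ioo]
  congr 1 with s
  by_cases h0 : 0 < s
  · by_cases h1 : s < 1
    · have hs : ∀ θ, circleMap 0 s θ ∈ disc := fun θ => by
        rwa [mem_disc, norm_circleMap_of_pos h0]
      rw [indicator_of_mem (mem_Ioi.2 h0), indicator_of_mem (mem_Ioo.2 ⟨h0, h1⟩),
        ← lintegral_const_mul' _ _ ENNReal.ofReal_ne_top]
      simp [hs]
    · have hs : ∀ θ, circleMap 0 s θ ∉ disc := fun θ => by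
        rwa [mem_disc, norm_circleMap_of_pos h0]
      rw [indicator_of_mem (mem_Ioi.2 h0), indicator_of_notMem (fun h => h1 h.2)]
      simp [hs]
  · rw [indicator_of_notMem (by simpa using h0), indicator_of_notMem (fun h => h0 h.1)]

theorem ae_circleMap_of_ae_area {P : ℂ → Prop} (h : ∀ᵐ z ∂area, P z) :
    ∀ᵐ s ∂volume.restrict (Ioo (0 : ℝ) 1),
      ∀ᵐ θ ∂volume.restrict (Ioo (-Real.pi) Real.pi), P (circleMap 0 s θ) := by
  obtain ⟨N, hN, hNm, hN0⟩ := exists_measurable_superset_of_null (ae_iff.1 h)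
  have h1 := lintegral_area_of_measurable (measurable_one.indicator hNm)
  rw [lintegral_indicator_one hNm, hN0, eq_comm, mul_eq_zero] at h1
  have h2 := h1.resolve_left (by simp)
  have hm : Measurable fun s : ℝ => ∫⁻ θ in Ioo (-Real.pi) Real.pi,
      N.indicator (1 : ℂ → ℝ≥0∞) (circleMap 0 s θ) :=
    ((measurable_one.indicator hNm).comp measurable_circleMap_prod).lintegral_prod_right'
  rw [lintegral_eq_zero_iff (by fun_prop)] at h2
  filter_upwards [h2, ae_restrict_mem measurableSet_Ioo] with s hs hs01
  simp only [Pi.zero_apply, mul_eq_zero, ENNReal.ofReal_eq_zero] at hs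
  have hs' := hs.resolve_left (not_le.2 hs01.1)
  rw [lintegral_eq_zero_iff (f := fun θ => N.indicator (1 : ℂ → ℝ≥0∞) (circleMap 0 s θ))
    ((measurable_one.indicator hNm).comp
      (measurable_circleMap_prod.comp measurable_prodMk_left))] at hs'
  filter_upwards [hs'] with θ hθ
  by_contra hP
  have : circleMap 0 s θ ∈ N := hN hP
  simp [this] at hθ

/-- Almost everywhere measurability is the right generality: a radial weight is only assumed
integrable. -/
theorem lintegral_area {g : ℂ → ℝ≥0∞} (hg : AEMeasurable g area) :
    ∫⁻ z, g z ∂area = (ENNReal.ofReal Real.pi)⁻¹ * ∫⁻ s in Ioo (0 : ℝ) 1,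
      ENNReal.ofReal s * ∫⁻ θ in Ioo (-Real.pi) Real.pi, g (circleMap 0 s θ) := by
  rw [lintegral_congr_ae hg.ae_eq_mk, lintegral_area_of_measurable hg.measurable_mk]
  congr 1
  refine lintegral_congr_ae ?_
  filter_upwards [ae_circleMap_of_ae_area hg.ae_eq_mk] with s hs
  congr 1
  exact lintegral_congr_ae (hs.mono fun _ h => h.symm)

end Polar

/-! ### Doubling weights, their tails, and the associated weight -/

section Weight

variable {ω : ℂ → ℝ}

theorem circleMap_mem_disc {s : ℝ} (hs : s ∈ Ioo (0 : ℝ) 1) (θ : ℝ) : circleMap 0 s θ ∈ disc := by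
  rw [mem_disc, norm_circleMap_of_pos hs.1]
  exact hs.2

theorem IsRadialWeight.apply_circleMap (hω : IsRadialWeight ω) {s : ℝ} (hs : s ∈ Ioo (0 : ℝ) 1)
    (θ : ℝ) : ω (circleMap 0 s θ) = ω s := by
  rw [hω.radial _ (circleMap_mem_disc hs θ), norm_circleMap_of_pos hs.1]

theorem IsRadialWeight.apply_nonneg (hω : IsRadialWeight ω) {s : ℝ} (hs : s ∈ Ioo (0 : ℝ) 1) :
    0 ≤ ω s := hω.nonneg _ (by simpa [mem_disc, abs_of_pos hs.1] using hs.2)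

theorem IsRadialWeight.aemeasurable_ofReal (hω : IsRadialWeight ω) :
    AEMeasurable (fun z => ENNReal.ofReal (ω z)) area :=
  hω.integrable.aemeasurable.ennreal_ofReal

theorem volume_angle : volume (Ioo (-Real.pi) Real.pi) = 2 * ENNReal.ofReal Real.pi := by
  rw [Real.volume_Ioo, ← ENNReal.ofReal_ofNat 2, ← ENNReal.ofReal_mul (by norm_num)]
  ring_nf

theorem inv_pi_mul_angle : (ENNReal.ofReal Real.pi)⁻¹ * (2 * ENNReal.ofReal Real.pi) = 2 := by
  rw [mul_comm, mul_assoc, ENNReal.mul_inv_cancel (by simp [Real.pi_pos]) (by simp), mul_one]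

/-- The radial profile of a radial weight is measurable. -/
theorem IsRadialWeight.aemeasurable_profile (hω : IsRadialWeight ω) :
    AEMeasurable (fun s : ℝ => ENNReal.ofReal (ω s)) (volume.restrict (Ioo (0 : ℝ) 1)) := by
  set W := hω.aemeasurable_ofReal.mk _ with hW
  have hWm : Measurable W := hω.aemeasurable_ofReal.measurable_mk
  -- A radius is a null set for area, so a measurable version of `ω` cannot simply be restricted to
  -- it; its averages over circles are measurable and recover ω(s) for almost every s.
  refine ⟨fun s => (2 * ENNReal.ofReal Real.pi)⁻¹ *
    ∫⁻ θ in Ioo (-Real.pi) Real.pi, W (circleMap 0 s θ), ?_, ?_⟩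
  · have : Measurable fun s : ℝ => ∫⁻ θ in Ioo (-Real.pi) Real.pi, W (circleMap 0 s θ) :=
      (hWm.comp measurable_circleMap_prod).lintegral_prod_right'
    fun_prop
  · filter_upwards [ae_circleMap_of_ae_area hω.aemeasurable_ofReal.ae_eq_mk,
      ae_restrict_mem measurableSet_Ioo] with s hs hs01
    have : ∫⁻ θ in Ioo (-Real.pi) Real.pi, W (circleMap 0 s θ) =
        ∫⁻ θ in Ioo (-Real.pi) Real.pi, ENNReal.ofReal (ω s) := by
      refine lintegral_congr_ae ?_
      filter_upwards [hs] with θ hθ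
      rw [hW, ← hθ, hω.apply_circleMap hs01]
    rw [this, setLIntegral_const, volume_angle, mul_comm, mul_assoc, ENNReal.mul_inv_cancel
      (by simp [Real.pi_pos]) (by finiteness), mul_one]

theorem weightedArea_absolutelyContinuous : weightedArea ω ≪ area :=
  withDensity_absolutelyContinuous _ _

theorem lintegral_weightedArea (hω : IsRadialWeight ω) {g : ℂ → ℝ≥0∞} (hg : AEMeasurable g area) :
    ∫⁻ z, g z ∂weightedArea ω = ∫⁻ z, ENNReal.ofReal (ω z) * g z ∂area :=
  lintegral_withDensity_eq_lintegral_mul₀ hω.aemeasurable_ofReal hg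

theorem lintegral_weightedArea_polar (hω : IsRadialWeight ω) {g : ℂ → ℝ≥0∞}
    (hg : AEMeasurable g area) :
    ∫⁻ z, g z ∂weightedArea ω = (ENNReal.ofReal Real.pi)⁻¹ * ∫⁻ s in Ioo (0 : ℝ) 1,
      ENNReal.ofReal (ω s) * (ENNReal.ofReal s *
        ∫⁻ θ in Ioo (-Real.pi) Real.pi, g (circleMap 0 s θ)) := by
  rw [lintegral_weightedArea hω hg,
    lintegral_area (g := fun z => ENNReal.ofReal (ω z) * g z) (hω.aemeasurable_ofReal.mul hg)]
  congr 1
  refine setLIntegral_congr_fun measurableSet_Ioo fun s hs => ?_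
  simp only [hω.apply_circleMap hs]
  rw [lintegral_const_mul' _ _ ENNReal.ofReal_ne_top, mul_left_comm]

theorem lintegral_weightedArea_radial (hω : IsRadialWeight ω) {h : ℝ → ℝ≥0∞} (hh : Measurable h) :
    ∫⁻ z, h ‖z‖ ∂weightedArea ω = 2 * ∫⁻ s in Ioo (0 : ℝ) 1,
      ENNReal.ofReal (ω s) * (ENNReal.ofReal s * h s) := by
  rw [lintegral_weightedArea_polar hω (g := fun z => h ‖z‖) (hh.comp measurable_norm).aemeasurable,
    ← inv_pi_mul_angle, mul_assoc,
    ← lintegral_const_mul' (2 * ENNReal.ofReal Real.pi) _ (by finiteness)]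
  congr 1
  refine setLIntegral_congr_fun measurableSet_Ioo fun s hs => ?_
  simp only [norm_circleMap_of_pos hs.1, setLIntegral_const, volume_angle]
  ring

/-- Integrability over the disc controls only ∫ ω(s) s ds. On (1/2, 1) the factor s is harmless, and
doubling at r = 0 brings the finiteness down to the origin. -/
theorem IsDoubling.tail_zero_lt_top (hω : IsDoubling ω) : tail ω 0 < ⊤ := by
  obtain ⟨C, hC⟩ := hω.doubling
  have h1 : ∫⁻ _, 1 ∂weightedArea ω < ⊤ := by
    rw [lintegral_weightedArea hω.weight aemeasurable_const]
    simpa using hω.weight.integrable.lintegral_lt_top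
  rw [lintegral_weightedArea_radial hω.weight (h := fun _ => 1) measurable_const] at h1
  have h3 : tail ω ((1 + 0) / 2) ≤ 2 * ∫⁻ s in Ioo (0 : ℝ) 1,
      ENNReal.ofReal (ω s) * (ENNReal.ofReal s * 1) := by
    rw [tail, ← lintegral_const_mul' _ _ (by simp)]
    refine (setLIntegral_mono' measurableSet_Ioo fun s hs => ?_).trans
      (lintegral_mono_set (Ioo_subset_Ioo_left (by norm_num)))
    rw [mul_one, ← ENNReal.ofReal_ofNat 2, mul_left_comm, ← ENNReal.ofReal_mul (by norm_num)]
    refine le_mul_of_one_le_right (zero_le) ?_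
    rw [ENNReal.one_le_ofReal]
    linarith [hs.1]
  exact (hC 0 (by simp)).trans_lt (ENNReal.mul_lt_top (by simp) (h3.trans_lt h1))

theorem IsDoubling.integrableOn (hω : IsDoubling ω) :
    IntegrableOn (fun s : ℝ => ω s) (Ioo 0 1) := by
  have hae : (fun s : ℝ => ω s) =ᵐ[volume.restrict (Ioo 0 1)]
      fun s => (ENNReal.ofReal (ω s)).toReal := by
    filter_upwards [ae_restrict_mem measurableSet_Ioo] with s hs
    rw [ENNReal.toReal_ofReal (hω.weight.apply_nonneg hs)]
  refine (integrable_congr hae).2 (integrable_toReal_of_lintegral_ne_top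
    hω.weight.aemeasurable_profile hω.tail_zero_lt_top.ne)

theorem tail_anti {r s : ℝ} (h : r ≤ s) : tail ω s ≤ tail ω r :=
  lintegral_mono_set (Ioo_subset_Ioo_left h)

theorem IsDoubling.tail_lt_top (hω : IsDoubling ω) {r : ℝ} (hr : 0 ≤ r) : tail ω r < ⊤ :=
  (tail_anti hr).trans_lt hω.tail_zero_lt_top

theorem IsDoubling.toReal_tail_pos (hω : IsDoubling ω) {r : ℝ} (hr : r ∈ Ico (0 : ℝ) 1) :
    0 < (tail ω r).toReal :=
  ENNReal.toReal_pos (hω.tail_pos r hr).ne' (hω.tail_lt_top hr.1).ne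

theorem IsDoubling.toReal_tail_anti (hω : IsDoubling ω) {r s : ℝ} (hr : 0 ≤ r) (h : r ≤ s) :
    (tail ω s).toReal ≤ (tail ω r).toReal :=
  ENNReal.toReal_mono (hω.tail_lt_top hr).ne (tail_anti h)

theorem IsDoubling.toReal_tail_eq (hω : IsDoubling ω) {r : ℝ} (hr : 0 ≤ r) :
    (tail ω r).toReal = ∫ s in Ioo r 1, ω (s : ℂ) := by
  have hsub : Ioo r 1 ⊆ Ioo 0 1 := Ioo_subset_Ioo_left hr
  rw [tail, integral_eq_lintegral_of_nonneg_ae]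
  · filter_upwards [ae_restrict_mem measurableSet_Ioo] with s hs
    exact hω.weight.apply_nonneg (hsub hs)
  · exact (hω.integrableOn.mono_set hsub).aestronglyMeasurable

/-- The doubling condition, with a constant at least `1` and for distances `x` to the boundary. -/
theorem IsDoubling.exists_doubling (hω : IsDoubling ω) : ∃ D : ℝ≥0, 1 ≤ D ∧
    ∀ x > 0, tail ω (max 0 (1 - 2 * x)) ≤ D * tail ω (max 0 (1 - x)) := by
  obtain ⟨C, hC⟩ := hω.doubling
  refine ⟨max C 1, le_max_right _ _, fun x hx => ?_⟩
  have hle : ∀ a : ℝ≥0∞, (C : ℝ≥0∞) * a ≤ ((max C 1 : ℝ≥0) : ℝ≥0∞) * a := fun a => by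
    gcongr
    exact le_max_left _ _
  rcases le_total x (1 / 2) with h | h
  · rw [max_eq_right (by linarith : 0 ≤ 1 - 2 * x), max_eq_right (by linarith : 0 ≤ 1 - x)]
    refine (hC (1 - 2 * x) ⟨by linarith, by linarith⟩).trans ((hle _).trans_eq ?_)
    ring_nf
  rw [max_eq_left (by linarith : 1 - 2 * x ≤ 0)]
  rcases le_total x 1 with h1 | h1
  · refine (hC 0 (by simp)).trans ((hle _).trans ?_)
    gcongr
    refine tail_anti (max_le (by norm_num) (by linarith))
  · rw [max_eq_left (by linarith : 1 - x ≤ 0)]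
    refine le_mul_of_one_le_left zero_le ?_
    exact_mod_cast le_max_right C 1

theorem tail_le_pow_mul {D : ℝ≥0}
    (hD : ∀ x > 0, tail ω (max 0 (1 - 2 * x)) ≤ D * tail ω (max 0 (1 - x)))
    {x : ℝ} (hx : 0 < x) (k : ℕ) :
    tail ω (max 0 (1 - 2 ^ k * x)) ≤ D ^ k * tail ω (max 0 (1 - x)) := by
  induction k with
  | zero => simp
  | succ k ih =>
    rw [pow_succ', mul_assoc, pow_succ', mul_assoc]
    exact (hD _ (by positivity)).trans (by gcongr)

/-- Tails at comparable distances from the boundary are comparable. -/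
theorem IsDoubling.exists_toReal_tail_le (hω : IsDoubling ω) (a : ℝ) : ∃ C > 0,
    ∀ r ∈ Ico (0 : ℝ) 1, ∀ s ∈ Ico (0 : ℝ) 1, 1 - r ≤ a * (1 - s) →
      (tail ω r).toReal ≤ C * (tail ω s).toReal := by
  obtain ⟨D, hD1, hD⟩ := hω.exists_doubling
  obtain ⟨k, hk⟩ := pow_unbounded_of_one_lt a (one_lt_two)
  refine ⟨D ^ k, by positivity, fun r hr s hs h => ?_⟩
  have h1 := tail_le_pow_mul hD (sub_pos.2 hs.2) k
  rw [sub_sub_cancel, max_eq_right hs.1] at h1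
  have h2 : tail ω r ≤ D ^ k * tail ω s := by
    refine (tail_anti (max_le hr.1 ?_)).trans h1
    have := mul_le_mul_of_nonneg_right hk.le (sub_pos.2 hs.2).le
    linarith
  have := ENNReal.toReal_mono (by have := hω.tail_lt_top hs.1; finiteness) h2
  simpa using this

/-- Dyadic shells: the exponential is at most exp(-2^k) where 2^k ≤ (1-s)/x < 2^(k+1), and at most 1
within distance x of the boundary. -/
theorem exp_neg_le_tsum {x s : ℝ} (hx : 0 < x) (hs : s ∈ Ioo (0 : ℝ) 1) :
    ENNReal.ofReal (Real.exp (-((1 - s) / x))) ≤ (Ioo (max 0 (1 - x)) 1).indicator 1 s +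
      ∑' k : ℕ, ENNReal.ofReal (Real.exp (-2 ^ k)) *
        (Ioo (max 0 (1 - 2 ^ (k + 1) * x)) 1).indicator 1 s := by
  by_cases h : 1 - x < s
  · have hm : s ∈ Ioo (max 0 (1 - x)) 1 := ⟨max_lt hs.1 h, hs.2⟩
    rw [indicator_of_mem hm]
    refine le_add_right ?_
    rw [Pi.one_apply, ENNReal.ofReal_le_one, Real.exp_le_one_iff, neg_nonpos]
    exact div_nonneg (by linarith [hs.2]) hx.le
  · obtain ⟨k, hk1, hk2⟩ := exists_nat_pow_near (x := (1 - s) / x) (y := (2 : ℝ))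
      (by rw [one_le_div hx]; linarith) one_lt_two
    refine le_add_left (le_trans ?_ (ENNReal.le_tsum k))
    have hm : s ∈ Ioo (max 0 (1 - 2 ^ (k + 1) * x)) 1 :=
      ⟨max_lt hs.1 (by rw [div_lt_iff₀ hx] at hk2; linarith), hs.2⟩
    rw [indicator_of_mem hm, Pi.one_apply, mul_one]
    exact ENNReal.ofReal_le_ofReal (Real.exp_le_exp.2 (by linarith))

theorem tsum_exp_neg_two_pow_lt_top (D : ℝ≥0) :
    ∑' k : ℕ, ENNReal.ofReal (Real.exp (-2 ^ k)) * (D : ℝ≥0∞) ^ (k + 1) < ⊤ := by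
  -- With 2D < 2^m one has (2D)^k ≤ (2^k)^m ≤ m! exp(2^k); the spare factor 2^k leaves a convergent
  -- geometric series.
  obtain ⟨m, hm⟩ := pow_unbounded_of_one_lt (2 * (D : ℝ)) one_lt_two
  have hs : Summable fun k : ℕ => Real.exp (-2 ^ k) * (D : ℝ) ^ (k + 1) := by
    refine Summable.of_nonneg_of_le (fun k => by positivity) (fun k => ?_)
      ((summable_geometric_two).mul_left (m.factorial * (D : ℝ)))
    have h1 := Real.pow_div_factorial_le_exp (2 ^ k) (by positivity) m
    have h2 : (2 * (D : ℝ)) ^ k ≤ (2 ^ k) ^ m := by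
      rw [← pow_mul, mul_comm k m, pow_mul]
      gcongr
    have h3 : (2 * (D : ℝ)) ^ k ≤ m.factorial * Real.exp (2 ^ k) := by
      rw [div_le_iff₀ (by positivity)] at h1
      linarith
    rw [Real.exp_neg, one_div, inv_pow, pow_succ, inv_mul_le_iff₀ (Real.exp_pos _)]
    rw [mul_pow] at h3
    have h4 : (D : ℝ) ^ k ≤ m.factorial * Real.exp (2 ^ k) * (2 ^ k)⁻¹ := by
      rw [← div_eq_mul_inv, le_div_iff₀ (by positivity)]
      linarith
    calc (D : ℝ) ^ k * D ≤ (m.factorial * Real.exp (2 ^ k) * (2 ^ k)⁻¹) * D := by gcongr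
      _ = _ := by ring
  have h : ∀ k : ℕ, ENNReal.ofReal (Real.exp (-2 ^ k)) * (D : ℝ≥0∞) ^ (k + 1) =
      ENNReal.ofReal (Real.exp (-2 ^ k) * (D : ℝ) ^ (k + 1)) := by
    intro k
    rw [ENNReal.ofReal_mul (Real.exp_pos _).le, ENNReal.ofReal_pow NNReal.zero_le_coe, ENNReal.ofReal_coe_nnreal]
  simp_rw [h]
  exact hs.tsum_ofReal_lt_top

/-- Exponential moments of a doubling weight are controlled by its tails. -/
theorem IsDoubling.exists_lintegral_exp_le (hω : IsDoubling ω) : ∃ C : ℝ≥0, ∀ r ∈ Ico (0 : ℝ) 1,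
    ∫⁻ s in Ioo (0 : ℝ) 1, ENNReal.ofReal (ω s) * ENNReal.ofReal (Real.exp (-((1 - s) / (1 - r))))
      ≤ C * tail ω r := by
  obtain ⟨D, hD1, hD⟩ := hω.exists_doubling
  set S := ∑' k : ℕ, ENNReal.ofReal (Real.exp (-2 ^ k)) * (D : ℝ≥0∞) ^ (k + 1) with hS
  have hStop : 1 + S < ⊤ := by
    have := tsum_exp_neg_two_pow_lt_top D
    finiteness
  refine ⟨(1 + S).toNNReal, fun r hr => ?_⟩
  rw [ENNReal.coe_toNNReal hStop.ne]
  have hx : 0 < 1 - r := sub_pos.2 hr.2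
  have hind : ∀ a : ℝ, ∫⁻ s in Ioo (0 : ℝ) 1, ENNReal.ofReal (ω s) *
      (Ioo (max 0 a) 1).indicator 1 s = tail ω (max 0 a) := by
    intro a
    rw [tail, ← Measure.restrict_restrict_of_subset
      (Ioo_subset_Ioo_left (le_max_left 0 a)),
      ← lintegral_indicator (μ := volume.restrict (Ioo 0 1)) measurableSet_Ioo]
    refine lintegral_congr fun s => ?_
    by_cases h : s ∈ Ioo (max 0 a) 1 <;> simp [h]
  have hmeas : ∀ a : ℝ, AEMeasurable (fun s : ℝ => ENNReal.ofReal (ω s) *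
      (Ioo (max 0 a) 1).indicator 1 s) (volume.restrict (Ioo (0 : ℝ) 1)) := fun a =>
    hω.weight.aemeasurable_profile.mul (measurable_one.indicator measurableSet_Ioo).aemeasurable
  calc _ ≤ ∫⁻ s in Ioo (0 : ℝ) 1, (ENNReal.ofReal (ω s) *
        (Ioo (max 0 (1 - (1 - r))) 1).indicator 1 s +
        ∑' k : ℕ, ENNReal.ofReal (Real.exp (-2 ^ k)) * (ENNReal.ofReal (ω s) *
          (Ioo (max 0 (1 - 2 ^ (k + 1) * (1 - r))) 1).indicator 1 s)) := by
        refine setLIntegral_mono' measurableSet_Ioo fun s hs => ?_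
        refine (mul_le_mul_right (exp_neg_le_tsum hx hs) _).trans_eq ?_
        rw [mul_add, ← ENNReal.tsum_mul_left]
        congr 2 with k
        ring
    _ = tail ω (max 0 (1 - (1 - r))) + ∑' k : ℕ, ENNReal.ofReal (Real.exp (-2 ^ k)) *
          tail ω (max 0 (1 - 2 ^ (k + 1) * (1 - r))) := by
        rw [lintegral_add_left' (hmeas _), hind, lintegral_tsum fun k => (hmeas _).const_mul _]
        simp_rw [lintegral_const_mul' _ _ ENNReal.ofReal_ne_top, hind]
    _ ≤ tail ω r + ∑' k : ℕ, ENNReal.ofReal (Real.exp (-2 ^ k)) * (D : ℝ≥0∞) ^ (k + 1) *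
          tail ω r := by
        rw [sub_sub_cancel, max_eq_right hr.1]
        refine add_le_add le_rfl (ENNReal.tsum_le_tsum fun k => ?_)
        have := tail_le_pow_mul hD hx (k + 1)
        rw [sub_sub_cancel, max_eq_right hr.1] at this
        rw [mul_assoc]
        gcongr
    _ = (1 + S) * tail ω r := by rw [ENNReal.tsum_mul_right, add_mul, one_mul]

theorem IsDoubling.star_integrableOn (hω : IsDoubling ω) {r : ℝ} (hr : r ∈ Ioo (0 : ℝ) 1) :
    IntegrableOn (fun s : ℝ => ω (s : ℂ) * Real.log (s / r) * s) (Ioo r 1) := by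
  have h := hω.integrableOn.mono_set (Ioo_subset_Ioo_left hr.1.le)
  have h2 : IntegrableOn (fun s : ℝ => (Real.log (s / r) * s) * ω (s : ℂ)) (Ioo r 1) := by
    refine Integrable.bdd_mul (c := Real.log (1 / r)) h (Measurable.aestronglyMeasurable
      (by fun_prop)) ?_
    filter_upwards [ae_restrict_mem measurableSet_Ioo] with s hs
    have hs0 : 0 < s := hr.1.trans hs.1
    have h0 : 0 ≤ Real.log (s / r) := Real.log_nonneg (by rw [one_le_div hr.1]; exact hs.1.le)
    rw [Real.norm_of_nonneg (by positivity)]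
    have h1 : Real.log (s / r) ≤ Real.log (1 / r) :=
      Real.log_le_log (div_pos hs0 hr.1) (by have := hs.2; have := hr.1; gcongr)
    nlinarith [hs.2]
  exact h2.congr (.of_forall fun s => by ring)

theorem star_eq_setIntegral {z : ℂ} (hz : z ∈ disc) :
    star ω z = ∫ s in Ioo ‖z‖ 1, ω (s : ℂ) * Real.log (s / ‖z‖) * s := by
  rw [star, intervalIntegral.integral_of_le (mem_disc.1 hz).le, integral_Ioc_eq_integral_Ioo]

theorem norm_mem_Ioo {z : ℂ} (hz : z ∈ disc) (h0 : z ≠ 0) : ‖z‖ ∈ Ioo (0 : ℝ) 1 :=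
  ⟨norm_pos_iff.2 h0, mem_disc.1 hz⟩

theorem norm_mem_Ico {z : ℂ} (hz : z ∈ disc) : ‖z‖ ∈ Ico (0 : ℝ) 1 :=
  ⟨norm_nonneg z, mem_disc.1 hz⟩

theorem IsDoubling.star_le_of_log_le (hω : IsDoubling ω) {z : ℂ} (hz : z ∈ disc) (h0 : z ≠ 0)
    {c : ℝ} (hc : ∀ s ∈ Ioo ‖z‖ 1, Real.log (s / ‖z‖) * s ≤ c) :
    star ω z ≤ c * (tail ω ‖z‖).toReal := by
  have hr := norm_mem_Ioo hz h0
  have hsub : Ioo ‖z‖ 1 ⊆ Ioo 0 1 := Ioo_subset_Ioo_left hr.1.le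
  rw [star_eq_setIntegral hz, hω.toReal_tail_eq hr.1.le, ← integral_const_mul]
  refine setIntegral_mono_on (hω.star_integrableOn hr)
    ((hω.integrableOn.mono_set hsub).const_mul c) measurableSet_Ioo fun s hs => ?_
  rw [mul_assoc, mul_comm]
  exact mul_le_mul_of_nonneg_right (hc s hs) (hω.weight.apply_nonneg (hsub hs))

theorem IsDoubling.star_le (hω : IsDoubling ω) {z : ℂ} (hz : z ∈ disc) (hz2 : 1 / 2 ≤ ‖z‖) :
    star ω z ≤ 2 * (1 - ‖z‖) * (tail ω ‖z‖).toReal := by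
  refine hω.star_le_of_log_le hz (by rintro rfl; norm_num at hz2) fun s hs => ?_
  have hr : 0 < ‖z‖ := by linarith
  have hs0 : 0 < s := hr.trans hs.1
  have h1 := Real.log_le_sub_one_of_pos (div_pos hs0 hr)
  have h2 : s / ‖z‖ - 1 ≤ 2 * (s - ‖z‖) := by
    rw [div_sub_one hr.ne', div_le_iff₀ hr]
    nlinarith [hs.1]
  nlinarith [hs.2, hs.1]

theorem IsDoubling.star_le_log (hω : IsDoubling ω) {z : ℂ} (hz : z ∈ disc) (h0 : z ≠ 0) :
    star ω z ≤ Real.log (1 / ‖z‖) * (tail ω 0).toReal := by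
  have hr := norm_mem_Ioo hz h0
  have hl : 0 ≤ Real.log (1 / ‖z‖) := Real.log_nonneg (by rw [one_le_div hr.1]; exact hr.2.le)
  refine (hω.star_le_of_log_le hz h0 (c := Real.log (1 / ‖z‖)) fun s hs => ?_).trans
    (mul_le_mul_of_nonneg_left (hω.toReal_tail_anti le_rfl hr.1.le) hl)
  have hs0 : 0 < s := hr.1.trans hs.1
  have h1 : Real.log (s / ‖z‖) ≤ Real.log (1 / ‖z‖) :=
    Real.log_le_log (div_pos hs0 hr.1) (by have := hs.2; have := hr.1; gcongr)
  nlinarith [hs.2]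

/-- Only radii beyond the midpoint are kept; there s log(s/|z|) ≥ s - |z| ≥ (1 - |z|)/2. -/
theorem IsDoubling.le_star (hω : IsDoubling ω) {z : ℂ} (hz : z ∈ disc) (h0 : z ≠ 0) :
    (1 - ‖z‖) / 2 * (tail ω ((1 + ‖z‖) / 2)).toReal ≤ star ω z := by
  have hr := norm_mem_Ioo hz h0
  have hsub : Ioo ‖z‖ 1 ⊆ Ioo 0 1 := Ioo_subset_Ioo_left hr.1.le
  have hsub2 : Ioo ((1 + ‖z‖) / 2) 1 ⊆ Ioo ‖z‖ 1 := Ioo_subset_Ioo_left (by linarith [hr.2])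
  rw [star_eq_setIntegral hz, hω.toReal_tail_eq (by linarith [hr.1]), ← integral_const_mul]
  refine (setIntegral_mono_on ((hω.integrableOn.mono_set (hsub2.trans hsub)).const_mul _)
    ((hω.star_integrableOn hr).mono_set hsub2) measurableSet_Ioo fun s hs => ?_).trans
    (setIntegral_mono_set (hω.star_integrableOn hr) ?_ (LE.le.eventuallyLE hsub2))
  · rw [mul_assoc, mul_comm]
    refine mul_le_mul_of_nonneg_left ?_ (hω.weight.apply_nonneg (hsub (hsub2 hs)))
    have hs0 : 0 < s := hr.1.trans (hsub2 hs).1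
    have h1 := Real.one_sub_inv_le_log_of_pos (div_pos hs0 hr.1)
    rw [inv_div] at h1
    have h2 : (1 - ‖z‖ / s) * s = s - ‖z‖ := by field_simp
    nlinarith [hs.1]
  · filter_upwards [ae_restrict_mem measurableSet_Ioo] with s hs
    have hs0 : 0 < s := hr.1.trans hs.1
    have h0 : 0 ≤ Real.log (s / ‖z‖) := Real.log_nonneg (by rw [one_le_div hr.1]; exact hs.1.le)
    exact mul_nonneg (mul_nonneg (hω.weight.apply_nonneg (hsub hs)) h0) hs0.le

theorem IsDoubling.star_pos (hω : IsDoubling ω) {z : ℂ} (hz : z ∈ disc) (h0 : z ≠ 0) :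
    0 < star ω z := by
  have hr := norm_mem_Ioo hz h0
  refine lt_of_lt_of_le (mul_pos (by linarith [hr.2]) (hω.toReal_tail_pos ⟨?_, ?_⟩))
    (hω.le_star hz h0)
  · linarith [hr.1]
  · linarith [hr.2]

theorem star_zero : star ω 0 = 0 := by simp [star]

theorem IsDoubling.star_nonneg (hω : IsDoubling ω) {z : ℂ} (hz : z ∈ disc) : 0 ≤ star ω z := by
  rcases eq_or_ne z 0 with rfl | h0
  · rw [star_zero]
  · exact (hω.star_pos hz h0).le

/-- The Jacobian of polar coordinates cancels 1/|z|, leaving twice the tail at 0. -/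
theorem IsDoubling.lintegral_inv_norm_lt_top (hω : IsDoubling ω) :
    ∫⁻ z, ENNReal.ofReal ‖z‖⁻¹ ∂weightedArea ω < ⊤ := by
  rw [lintegral_weightedArea_radial hω.weight (h := fun s => ENNReal.ofReal s⁻¹) (by fun_prop)]
  have : ∫⁻ s in Ioo (0 : ℝ) 1, ENNReal.ofReal (ω s) * (ENNReal.ofReal s * ENNReal.ofReal s⁻¹)
      = tail ω 0 := by
    refine setLIntegral_congr_fun measurableSet_Ioo fun s hs => ?_
    rw [← ENNReal.ofReal_mul hs.1.le, mul_inv_cancel₀ hs.1.ne']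
    simp
  rw [this]
  have := hω.tail_zero_lt_top
  finiteness

theorem IsDoubling.isFiniteMeasure_weightedArea (hω : IsDoubling ω) :
    IsFiniteMeasure (weightedArea ω) :=
  isFiniteMeasure_withDensity_ofReal hω.weight.integrable.2

end Weight

end WeightedBergman

namespace WeightedBergman

open Filter Topology

/-! ### Point evaluations, completeness and reproducing kernels -/

section PointEvaluation

variable {ω : ℂ → ℝ}

theorem ofReal_norm_sq (x : ℂ) : ENNReal.ofReal (‖x‖ ^ 2) = ‖x‖ₑ ^ 2 := by
  rw [ENNReal.ofReal_pow (norm_nonneg x), ofReal_norm]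

theorem lintegral_angle_eq_ofReal {g : ℂ → ℝ} {s : ℝ}
    (hg : Continuous fun θ => g (circleMap 0 s θ)) (h0 : ∀ z, 0 ≤ g z) :
    ∫⁻ θ in Ioo (-Real.pi) Real.pi, ENNReal.ofReal (g (circleMap 0 s θ)) =
      ENNReal.ofReal (∫ θ in -Real.pi..Real.pi, g (circleMap 0 s θ)) := by
  rw [intervalIntegral.integral_of_le (by linarith [Real.pi_pos]), integral_Ioc_eq_integral_Ioo,
    ofReal_integral_eq_lintegral_ofReal]
  · exact (hg.integrableOn_Icc (a := -Real.pi) (b := Real.pi)).mono_set Ioo_subset_Icc_self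
  · exact .of_forall fun θ => h0 _

theorem continuous_comp_circleMap {F : ℂ → ℂ} (hF : ContinuousOn F disc) {s : ℝ}
    (hs : s ∈ Ioo (0 : ℝ) 1) : Continuous fun θ => F (circleMap 0 s θ) :=
  hF.comp_continuous (continuous_circleMap 0 s) fun θ => circleMap_mem_disc hs θ

/-- The value of an analytic function is controlled by its mean over a larger circle. -/
theorem norm_mul_le_integral {G : ℂ → ℂ} (hG : DifferentiableOn ℂ G disc) {s : ℝ}
    (hs : s ∈ Ioo (0 : ℝ) 1) {z : ℂ} (hz : ‖z‖ < s) :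
    2 * Real.pi * (s - ‖z‖) * ‖G z‖ ≤
      s * ∫ θ in -Real.pi..Real.pi, ‖G (circleMap 0 s θ)‖ := by
  have hsub : closure (Metric.ball (0 : ℂ) s) ⊆ disc := by
    rw [closure_ball _ hs.1.ne']
    intro w hw
    rw [mem_closedBall_zero_iff] at hw
    exact mem_disc.2 (hw.trans_lt hs.2)
  have hd : DiffContOnCl ℂ G (Metric.ball 0 s) := (hG.mono hsub).diffContOnCl
  have h1 := hd.two_pi_i_inv_smul_circleIntegral_sub_inv_smul (w := z) (by simpa using hz)
  have hcont := (continuous_comp_circleMap hG.continuousOn hs).norm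
  have h2 : ‖∮ w in C(0, s), (w - z)⁻¹ • G w‖ ≤
      ∫ θ in 0..2 * Real.pi, s / (s - ‖z‖) * ‖G (circleMap 0 s θ)‖ := by
    refine intervalIntegral.norm_integral_le_of_norm_le (by linarith [Real.pi_pos])
      (.of_forall fun θ _ => ?_) ((hcont.const_mul _).intervalIntegrable _ _)
    have h3 : s - ‖z‖ ≤ ‖circleMap 0 s θ - z‖ := by
      have := norm_sub_norm_le (circleMap 0 s θ) z
      rwa [norm_circleMap_of_pos hs.1] at this
    simp only [smul_eq_mul]
    rw [norm_mul, norm_mul, deriv_circleMap, norm_mul,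
      norm_circleMap_of_pos hs.1, Complex.norm_I, mul_one, norm_inv, ← mul_assoc, div_eq_mul_inv]
    have := sub_pos.2 hz
    have := hs.1
    gcongr
  have h3 : Function.Periodic (fun θ => ‖G (circleMap 0 s θ)‖) (2 * Real.pi) :=
    fun θ => by simp [periodic_circleMap 0 s θ]
  have h4 := h3.intervalIntegral_add_eq 0 (-Real.pi)
  rw [zero_add, show -Real.pi + 2 * Real.pi = Real.pi by ring] at h4
  rw [intervalIntegral.integral_const_mul, h4] at h2
  have h5 : 2 * Real.pi * ‖G z‖ = ‖∮ w in C(0, s), (w - z)⁻¹ • G w‖ := by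
    rw [← h1, norm_smul]
    have : ‖(2 * (Real.pi : ℂ) * Complex.I)⁻¹‖ = (2 * Real.pi)⁻¹ := by
      simp [abs_of_pos Real.pi_pos]
    rw [this, mul_inv_cancel_left₀ (by positivity)]
  rw [← h5, div_mul_eq_mul_div, le_div_iff₀ (sub_pos.2 hz)] at h2
  linarith

theorem aemeasurable_area_of_continuousOn {E : Type*} [TopologicalSpace E] [MeasurableSpace E]
    [BorelSpace E] {F : ℂ → E} (hF : ContinuousOn F disc) : AEMeasurable F area :=
  (hF.aemeasurable measurableSet_disc).smul_measure _

theorem aestronglyMeasurable_weightedArea {F : ℂ → ℂ} (hF : ContinuousOn F disc) :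
    AEStronglyMeasurable F (weightedArea ω) :=
  ((aemeasurable_area_of_continuousOn hF).mono_ac
    weightedArea_absolutelyContinuous).aestronglyMeasurable

theorem aemeasurable_enorm_sq {F : ℂ → ℂ} (hF : ContinuousOn F disc) :
    AEMeasurable (fun z => ‖F z‖ₑ ^ 2) area := by
  have := aemeasurable_area_of_continuousOn hF
  fun_prop

/-- Point evaluation on the weighted Bergman space. -/
theorem enorm_sq_mul_tail_le (hω : IsRadialWeight ω) {F : ℂ → ℂ} (hF : DifferentiableOn ℂ F disc)
    {z : ℂ} (hz : z ∈ disc) :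
    ENNReal.ofReal (‖F z‖ ^ 2 * (1 - ‖z‖)) * tail ω ((1 + ‖z‖) / 2) ≤
      ∫⁻ w, ‖F w‖ₑ ^ 2 ∂weightedArea ω := by
  have hz1 := mem_disc.1 hz
  have hz0 := norm_nonneg z
  have hsub : Ioo ((1 + ‖z‖) / 2) 1 ⊆ Ioo 0 1 := Ioo_subset_Ioo_left (by linarith)
  rw [lintegral_weightedArea_polar hω (aemeasurable_enorm_sq hF.continuousOn), tail,
    ← lintegral_const_mul' _ _ ENNReal.ofReal_ne_top, ← lintegral_const_mul' _ _ (by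
      simp [Real.pi_pos])]
  -- Only circles beyond the midpoint are used: there 1 - |z| ≤ 2 (s - |z|), and the mean value
  -- bound applies to F² on each of them.
  refine (setLIntegral_mono' measurableSet_Ioo fun s hs => ?_).trans (lintegral_mono_set hsub)
  have hs01 := hsub hs
  have hzs : ‖z‖ < s := by linarith [hs.1]
  simp_rw [← ofReal_norm_sq]
  rw [lintegral_angle_eq_ofReal (g := fun w => ‖F w‖ ^ 2)
    ((continuous_comp_circleMap hF.continuousOn hs01).norm.pow 2) (fun _ => sq_nonneg _)]
  have h1 := norm_mul_le_integral (hF.pow 2) hs01 hzs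
  simp only [Pi.pow_apply, norm_pow] at h1
  rw [mul_left_comm, mul_comm (ENNReal.ofReal (_ * _))]
  gcongr
  rw [← ENNReal.ofReal_mul hs01.1.le, ← ENNReal.ofReal_inv_of_pos Real.pi_pos,
    ← ENNReal.ofReal_mul (by positivity)]
  refine ENNReal.ofReal_le_ofReal ?_
  rw [le_inv_mul_iff₀ Real.pi_pos]
  refine le_trans ?_ h1
  have : 1 - ‖z‖ ≤ 2 * (s - ‖z‖) := by linarith [hs.1]
  have h3 : 0 ≤ Real.pi * ‖F z‖ ^ 2 := by positivity
  nlinarith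

theorem enorm_sq_eq_lintegral (f : Lp ℂ 2 (weightedArea ω)) {F : ℂ → ℂ}
    (h : f =ᵐ[weightedArea ω] F) : ‖f‖ₑ ^ 2 = ∫⁻ z, ‖F z‖ₑ ^ 2 ∂weightedArea ω := by
  have h1 := eLpNorm_nnreal_pow_eq_lintegral (μ := weightedArea ω) (f := f) (p := 2) (by norm_num)
  rw [Lp.enorm_def]
  norm_num at h1
  rw [show (2 : ℝ≥0∞) = ((2 : ℝ≥0) : ℝ≥0∞) by norm_num] at *
  refine Eq.trans ?_ (h1.trans ?_)
  · norm_num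
  · refine lintegral_congr_ae (h.mono fun z hz => ?_)
    simp only [hz]

theorem norm_sq_eq_toReal (f : Lp ℂ 2 (weightedArea ω)) {F : ℂ → ℂ}
    (h : f =ᵐ[weightedArea ω] F) : ‖f‖ ^ 2 = (∫⁻ z, ‖F z‖ₑ ^ 2 ∂weightedArea ω).toReal := by
  rw [← enorm_sq_eq_lintegral f h, ENNReal.toReal_pow, toReal_enorm]

/-- The analytic representative of an element of the Bergman space. -/
noncomputable def rep (f : bergmanSpace ω) : ℂ → ℂ := f.2.choose

theorem rep_differentiableOn (f : bergmanSpace ω) : DifferentiableOn ℂ (rep f) disc :=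
  f.2.choose_spec.1

theorem coe_ae_eq_rep (f : bergmanSpace ω) :
    (f : Lp ℂ 2 (weightedArea ω)) =ᵐ[weightedArea ω] rep f :=
  f.2.choose_spec.2

/-- The constant in the point evaluation estimate. -/
noncomputable def evalConst (ω : ℂ → ℝ) (r : ℝ) : ℝ := (1 - r) * (tail ω ((1 + r) / 2)).toReal

theorem IsDoubling.evalConst_pos (hω : IsDoubling ω) {r : ℝ} (hr : r ∈ Ico (0 : ℝ) 1) :
    0 < evalConst ω r :=
  mul_pos (by linarith [hr.2]) (hω.toReal_tail_pos ⟨by linarith [hr.1], by linarith [hr.2]⟩)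

theorem IsDoubling.evalConst_anti (hω : IsDoubling ω) {r s : ℝ} (hr : 0 ≤ r) (hrs : r ≤ s)
    (hs : s ≤ 1) : evalConst ω s ≤ evalConst ω r :=
  mul_le_mul (by linarith) (hω.toReal_tail_anti (by linarith) (by linarith)) ENNReal.toReal_nonneg
    (by linarith)

theorem IsDoubling.norm_sq_mul_le (hω : IsDoubling ω) (f : bergmanSpace ω) {F : ℂ → ℂ}
    (hF : DifferentiableOn ℂ F disc) (h : (f : Lp ℂ 2 (weightedArea ω)) =ᵐ[weightedArea ω] F)
    {z : ℂ} (hz : z ∈ disc) : ‖F z‖ ^ 2 * evalConst ω ‖z‖ ≤ ‖f‖ ^ 2 := by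
  have h1 := enorm_sq_mul_tail_le hω.weight hF hz
  rw [← enorm_sq_eq_lintegral _ h] at h1
  have h2 := ENNReal.toReal_mono (by finiteness) h1
  rw [ENNReal.toReal_mul, ENNReal.toReal_ofReal (mul_nonneg (sq_nonneg _)
    (by linarith [mem_disc.1 hz])), ENNReal.toReal_pow, toReal_enorm] at h2
  rw [evalConst, ← mul_assoc]
  exact h2

/-- F - G represents the zero element, so point evaluation makes it vanish at every point of the
disc. -/
theorem IsDoubling.eqOn_of_ae_eq (hω : IsDoubling ω) {F G : ℂ → ℂ}
    (hF : DifferentiableOn ℂ F disc) (hG : DifferentiableOn ℂ G disc)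
    (h : F =ᵐ[weightedArea ω] G) : EqOn F G disc := by
  intro z hz
  have h0 : ((0 : bergmanSpace ω) : Lp ℂ 2 (weightedArea ω)) =ᵐ[weightedArea ω] F - G := by
    rw [Submodule.coe_zero]
    filter_upwards [Lp.coeFn_zero ℂ 2 (weightedArea ω), h] with w hw1 hw2
    rw [hw1, Pi.sub_apply, hw2, sub_self, Pi.zero_apply]
  have h1 := hω.norm_sq_mul_le 0 (hF.sub hG) h0 hz
  have h2 := hω.evalConst_pos (norm_mem_Ico hz)
  rw [norm_zero, zero_pow two_ne_zero] at h1
  have h3 : ‖(F - G) z‖ ^ 2 = 0 := by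
    by_contra hne
    have : 0 < ‖(F - G) z‖ ^ 2 := lt_of_le_of_ne (sq_nonneg _) (Ne.symm hne)
    nlinarith
  simpa [sub_eq_zero] using h3

theorem IsDoubling.rep_eq (hω : IsDoubling ω) {f : bergmanSpace ω} {F : ℂ → ℂ}
    (hF : DifferentiableOn ℂ F disc) (h : (f : Lp ℂ 2 (weightedArea ω)) =ᵐ[weightedArea ω] F)
    {z : ℂ} (hz : z ∈ disc) : rep f z = F z :=
  hω.eqOn_of_ae_eq (rep_differentiableOn f) hF ((coe_ae_eq_rep f).symm.trans h) hz

theorem coe_add_ae_eq (f g : bergmanSpace ω) :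
    ((f + g : bergmanSpace ω) : Lp ℂ 2 (weightedArea ω)) =ᵐ[weightedArea ω] rep f + rep g := by
  rw [Submodule.coe_add]
  filter_upwards [Lp.coeFn_add (f : Lp ℂ 2 (weightedArea ω)) g, coe_ae_eq_rep f,
    coe_ae_eq_rep g] with z h1 h2 h3
  rw [h1, Pi.add_apply, Pi.add_apply, h2, h3]

theorem coe_sub_ae_eq (f g : bergmanSpace ω) :
    ((f - g : bergmanSpace ω) : Lp ℂ 2 (weightedArea ω)) =ᵐ[weightedArea ω] rep f - rep g := by
  rw [Submodule.coe_sub]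
  filter_upwards [Lp.coeFn_sub (f : Lp ℂ 2 (weightedArea ω)) g, coe_ae_eq_rep f,
    coe_ae_eq_rep g] with z h1 h2 h3
  rw [h1, Pi.sub_apply, Pi.sub_apply, h2, h3]

theorem coe_smul_ae_eq (c : ℂ) (f : bergmanSpace ω) :
    ((c • f : bergmanSpace ω) : Lp ℂ 2 (weightedArea ω)) =ᵐ[weightedArea ω] c • rep f := by
  rw [Submodule.coe_smul]
  filter_upwards [Lp.coeFn_smul c (f : Lp ℂ 2 (weightedArea ω)), coe_ae_eq_rep f] with z h1 h2
  rw [h1, Pi.smul_apply, Pi.smul_apply, h2]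

theorem IsDoubling.rep_add (hω : IsDoubling ω) (f g : bergmanSpace ω) {z : ℂ} (hz : z ∈ disc) :
    rep (f + g) z = rep f z + rep g z :=
  hω.rep_eq ((rep_differentiableOn f).add (rep_differentiableOn g)) (coe_add_ae_eq f g) hz

theorem IsDoubling.rep_smul (hω : IsDoubling ω) (c : ℂ) (f : bergmanSpace ω) {z : ℂ}
    (hz : z ∈ disc) : rep (c • f) z = c * rep f z :=
  hω.rep_eq ((rep_differentiableOn f).const_smul c) (coe_smul_ae_eq c f) hz

theorem IsDoubling.rep_sub (hω : IsDoubling ω) (f g : bergmanSpace ω) {z : ℂ} (hz : z ∈ disc) :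
    rep (f - g) z = rep f z - rep g z :=
  hω.rep_eq ((rep_differentiableOn f).sub (rep_differentiableOn g)) (coe_sub_ae_eq f g) hz

theorem IsDoubling.norm_sq_rep_le (hω : IsDoubling ω) (f : bergmanSpace ω) {z : ℂ}
    (hz : z ∈ disc) : ‖rep f z‖ ^ 2 * evalConst ω ‖z‖ ≤ ‖f‖ ^ 2 :=
  hω.norm_sq_mul_le f (rep_differentiableOn f) (coe_ae_eq_rep f) hz

theorem exists_bergmanSpace_of_lintegral_lt_top {F : ℂ → ℂ} (hF : DifferentiableOn ℂ F disc)
    (h : ∫⁻ z, ‖F z‖ₑ ^ 2 ∂weightedArea ω < ⊤) :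
    ∃ f : bergmanSpace ω, (f : Lp ℂ 2 (weightedArea ω)) =ᵐ[weightedArea ω] F := by
  have hm : MemLp F 2 (weightedArea ω) := by
    refine ⟨aestronglyMeasurable_weightedArea hF.continuousOn, ?_⟩
    rw [eLpNorm_lt_top_iff_lintegral_rpow_enorm_lt_top (by norm_num) (by norm_num)]
    simpa using h
  exact ⟨⟨hm.toLp, F, hF, hm.coeFn_toLp⟩, hm.coeFn_toLp⟩

/-- Point evaluation turns norm convergence into locally uniform convergence of the representatives,
so their limit is analytic; an almost everywhere convergent subsequence identifies it with the L²
limit. -/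
theorem IsDoubling.isClosed_bergmanSpace (hω : IsDoubling ω) :
    IsClosed (bergmanSpace ω : Set (Lp ℂ 2 (weightedArea ω))) := by
  refine IsSeqClosed.isClosed fun u f hu huf => ?_
  set v : ℕ → bergmanSpace ω := fun n => ⟨u n, hu n⟩ with hv
  have hcauchy : CauchySeq v := by
    refine Metric.cauchySeq_iff.2 fun ε hε => ?_
    obtain ⟨N, hN⟩ := Metric.cauchySeq_iff.1 huf.cauchySeq ε hε
    exact ⟨N, fun m hm n hn => hN m hm n hn⟩
  have hunif : ∀ ρ ∈ Ico (0 : ℝ) 1,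
      UniformCauchySeqOn (fun n => rep (v n)) atTop (Metric.closedBall 0 ρ) := by
    intro ρ hρ
    rw [Metric.uniformCauchySeqOn_iff]
    intro ε hε
    have hc := hω.evalConst_pos hρ
    obtain ⟨N, hN⟩ := Metric.cauchySeq_iff.1 hcauchy (ε * √(evalConst ω ρ)) (by positivity)
    refine ⟨N, fun m hm n hn z hz => ?_⟩
    rw [mem_closedBall_zero_iff] at hz
    have hzd : z ∈ disc := mem_disc.2 (hz.trans_lt hρ.2)
    have h1 := hω.norm_sq_rep_le (v m - v n) hzd
    rw [hω.rep_sub _ _ hzd] at h1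
    have h2 := hN m hm n hn
    rw [dist_eq_norm] at h2 ⊢
    have h3 := hω.evalConst_anti (norm_nonneg z) hz hρ.2.le
    have h4 : ‖v m - v n‖ ^ 2 < (ε * √(evalConst ω ρ)) ^ 2 := by gcongr
    rw [mul_pow, Real.sq_sqrt hc.le] at h4
    have h5 : ‖rep (v m) z - rep (v n) z‖ ^ 2 * evalConst ω ρ < ε ^ 2 * evalConst ω ρ :=
      ((mul_le_mul_of_nonneg_left h3 (sq_nonneg _)).trans h1).trans_lt h4
    exact lt_of_pow_lt_pow_left₀ 2 hε.le (lt_of_mul_lt_mul_right h5 hc.le)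
  have hlim : ∀ z ∈ disc, ∃ w, Tendsto (fun n => rep (v n) z) atTop (𝓝 w) := fun z hz =>
    cauchySeq_tendsto_of_complete ((hunif ‖z‖ (norm_mem_Ico hz)).cauchySeq (by simp))
  choose! F hF using hlim
  have hloc : TendstoLocallyUniformlyOn (fun n => rep (v n)) F atTop disc := by
    intro s hs z hz
    obtain ⟨ρ, hzρ, hρ⟩ := exists_between (mem_disc.1 hz)
    have hρ0 : 0 ≤ ρ := (norm_nonneg z).trans hzρ.le
    have h1 := (hunif ρ ⟨hρ0, hρ⟩).tendstoUniformlyOn_of_tendsto fun w hw =>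
      hF w (mem_disc.2 ((mem_closedBall_zero_iff.1 hw).trans_lt hρ))
    exact ⟨Metric.closedBall 0 ρ, mem_nhdsWithin_of_mem_nhds
      (Metric.closedBall_mem_nhds_of_mem (by simpa using hzρ)), h1 s hs⟩
  have hdiff : DifferentiableOn ℂ F disc :=
    hloc.differentiableOn (.of_forall fun n => rep_differentiableOn (v n)) isOpen_disc
  refine ⟨F, hdiff, ?_⟩
  obtain ⟨ns, hns, hae⟩ := (tendstoInMeasure_of_tendsto_Lp huf).exists_seq_tendsto_ae
  have hall : ∀ᵐ z ∂weightedArea ω, ∀ n, u n z = rep (v n) z :=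
    ae_all_iff.2 fun n => coe_ae_eq_rep (v n)
  have hdisc : ∀ᵐ z ∂weightedArea ω, z ∈ disc :=
    weightedArea_absolutelyContinuous.ae_le
      (Measure.ae_smul_measure (ae_restrict_mem measurableSet_disc) _)
  filter_upwards [hae, hall, hdisc] with z h1 h2 h3
  refine tendsto_nhds_unique h1 ?_
  simp_rw [h2]
  exact (hF z h3).comp hns.tendsto_atTop

theorem IsDoubling.completeSpace (hω : IsDoubling ω) : CompleteSpace (bergmanSpace ω) :=
  hω.isClosed_bergmanSpace.completeSpace_coe

/-- The reproducing kernels. -/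
theorem IsDoubling.exists_kernel (hω : IsDoubling ω) : ∃ K : ℂ → bergmanSpace ω,
    ∀ z ∈ disc, ∀ f, inner ℂ (K z) f = rep f z := by
  have := hω.completeSpace
  have h : ∀ z, ∃ k : bergmanSpace ω, z ∈ disc → ∀ f, inner ℂ k f = rep f z := by
    intro z
    by_cases hz : z ∈ disc
    · let L : bergmanSpace ω →ₗ[ℂ] ℂ :=
        { toFun := fun f => rep f z
          map_add' := fun f g => hω.rep_add f g hz
          map_smul' := fun c f => hω.rep_smul c f hz }
      have hc := hω.evalConst_pos (norm_mem_Ico hz)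
      let L' := L.mkContinuous (√(evalConst ω ‖z‖))⁻¹ fun f => by
        have h1 := hω.norm_sq_rep_le f hz
        rw [inv_mul_eq_div, le_div_iff₀ (by positivity)]
        refine (abs_le_of_sq_le_sq' ?_ (norm_nonneg f)).2
        rwa [mul_pow, Real.sq_sqrt hc.le]
      refine ⟨(InnerProductSpace.toDual ℂ (bergmanSpace ω)).symm L', fun _ f => ?_⟩
      rw [InnerProductSpace.toDual_symm_apply]
      rfl
    · exact ⟨0, fun h => absurd h hz⟩
  choose K hK using h
  exact ⟨K, fun z hz => hK z hz⟩

end PointEvaluation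

end WeightedBergman

namespace WeightedBergman

open Filter Topology ComplexConjugate

/-! ### Schwarz–Pick and the comparison of ω⋆(z) with ω⋆(φ(z)) -/

section SchwarzPick

theorem norm_sq_one_sub_conj_mul_sub (b w : ℂ) :
    ‖1 - conj b * w‖ ^ 2 - ‖w - b‖ ^ 2 = (1 - ‖b‖ ^ 2) * (1 - ‖w‖ ^ 2) := by
  simp only [← Complex.normSq_eq_norm_sq, Complex.normSq_apply, Complex.sub_re, Complex.sub_im,
    Complex.mul_re, Complex.mul_im, Complex.conj_re, Complex.conj_im, Complex.one_re,
    Complex.one_im]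
  ring

/-- A consequence of the Schwarz--Pick inequality: a self-map of the disc does not decrease the
distance to the boundary by more than a constant factor. -/
theorem exists_one_sub_norm_le {φ : ℂ → ℂ} (hφ : DifferentiableOn ℂ φ disc)
    (hmaps : MapsTo φ disc disc) : ∃ a > 0, ∀ z ∈ disc, 1 - ‖z‖ ≤ a * (1 - ‖φ z‖) := by
  have h0 : (0 : ℂ) ∈ disc := by simp [disc]
  set b := φ 0 with hb
  have hb1 : ‖b‖ < 1 := mem_disc.1 (hmaps h0)
  have hden : ∀ w ∈ disc, 1 - ‖b‖ ≤ ‖1 - conj b * w‖ := by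
    intro w hw
    have h1 := norm_sub_norm_le 1 (conj b * w)
    rw [norm_one, norm_mul, Complex.norm_conj] at h1
    have := mul_le_mul_of_nonneg_left (mem_disc.1 hw).le (norm_nonneg b)
    linarith
  have hden0 : ∀ w ∈ disc, 1 - conj b * w ≠ 0 := fun w hw h => by
    have := hden w hw
    rw [h, norm_zero] at this
    linarith
  -- A disc automorphism carries φ(0) to 0, so the Schwarz lemma gives |g(z)| ≤ |z|; the identity
  -- above converts this into a bound for 1 - |φ(z)|².
  set g : ℂ → ℂ := fun z => (φ z - b) / (1 - conj b * φ z) with hg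
  have hgd : DifferentiableOn ℂ g disc :=
    (hφ.sub_const b).div ((differentiableOn_const 1).sub (hφ.const_mul _))
      fun z hz => hden0 _ (hmaps hz)
  have hid : ∀ z ∈ disc, 0 < (1 - ‖b‖ ^ 2) * (1 - ‖φ z‖ ^ 2) := by
    intro z hz
    have h1 := mem_disc.1 (hmaps hz)
    have h2 := norm_nonneg (φ z)
    have h3 := norm_nonneg b
    exact mul_pos (by nlinarith) (by nlinarith)
  have hgm : MapsTo g disc (Metric.closedBall 0 1) := by
    intro z hz
    have h1 := norm_sq_one_sub_conj_mul_sub b (φ z)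
    have h2 := hid z hz
    rw [mem_closedBall_zero_iff, hg, norm_div,
      div_le_one (norm_pos_iff.2 (hden0 _ (hmaps hz)))]
    exact (abs_le_of_sq_le_sq' (by linarith) (norm_nonneg _)).2
  have hg0 : g 0 = 0 := by simp [hg, hb]
  refine ⟨2 * 2 / (1 - ‖b‖) ^ 2, by have := sub_pos.2 hb1; positivity, fun z hz => ?_⟩
  have h1 : ‖g z‖ ≤ ‖z‖ := Complex.norm_le_norm_of_mapsTo_ball hgd hgm hg0 (mem_disc.1 hz)
  have hz1 := mem_disc.1 hz
  have hw1 := mem_disc.1 (hmaps hz)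
  rw [hg, norm_div, div_le_iff₀ (norm_pos_iff.2 (hden0 _ (hmaps hz)))] at h1
  have h2 : ‖φ z - b‖ ^ 2 ≤ ‖z‖ ^ 2 * ‖1 - conj b * φ z‖ ^ 2 := by
    rw [← mul_pow]
    gcongr
  have h3 := norm_sq_one_sub_conj_mul_sub b (φ z)
  have h4 : (1 - ‖b‖) ^ 2 ≤ ‖1 - conj b * φ z‖ ^ 2 := by
    have := hden _ (hmaps hz)
    have := sub_pos.2 hb1
    gcongr
  have h5 : (1 - ‖z‖) * (1 - ‖b‖) ^ 2 ≤ (1 - ‖b‖ ^ 2) * (1 - ‖φ z‖ ^ 2) := by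
    have h6 : (1 - ‖z‖) ≤ 1 - ‖z‖ ^ 2 := by nlinarith [norm_nonneg z]
    calc (1 - ‖z‖) * (1 - ‖b‖) ^ 2 ≤ (1 - ‖z‖ ^ 2) * ‖1 - conj b * φ z‖ ^ 2 := by
          have : 0 ≤ 1 - ‖z‖ := by linarith
          gcongr
          linarith
      _ ≤ _ := by linarith
  rw [div_mul_eq_mul_div, le_div_iff₀ (by have := sub_pos.2 hb1; positivity)]
  refine h5.trans ?_
  have h7 : 1 - ‖b‖ ^ 2 ≤ 2 := by nlinarith [sq_nonneg ‖b‖]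
  have h8 : 1 - ‖φ z‖ ^ 2 ≤ 2 * (1 - ‖φ z‖) := by nlinarith [sq_nonneg (1 - ‖φ z‖)]
  have h9 : 0 ≤ 1 - ‖b‖ ^ 2 := by nlinarith [norm_nonneg b]
  nlinarith

/-- Both factors of (1-|z|) ω̂(|z|) are compared, the distance by Schwarz–Pick and the tail by
doubling. The restriction |z| ≥ 1/2 avoids the logarithmic singularity of ω⋆(z). -/
theorem IsDoubling.exists_star_le_star_comp {ω : ℂ → ℝ} (hω : IsDoubling ω) {φ : ℂ → ℂ}
    (hφ : DifferentiableOn ℂ φ disc) (hmaps : MapsTo φ disc disc) :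
    ∃ C > 0, ∀ z ∈ disc, 1 / 2 ≤ ‖z‖ → φ z ≠ 0 → star ω z ≤ C * star ω (φ z) := by
  obtain ⟨a, ha, hφa⟩ := exists_one_sub_norm_le hφ hmaps
  obtain ⟨C, hC, htail⟩ := hω.exists_toReal_tail_le (2 * a)
  refine ⟨4 * a * C, by positivity, fun z hz hz2 h0 => ?_⟩
  have hw := norm_mem_Ico (hmaps hz)
  have h1 := hω.star_le hz hz2
  have h2 := hω.le_star (hmaps hz) h0
  have h3 := hφa z hz
  have h4 := htail ‖z‖ (norm_mem_Ico hz) ((1 + ‖φ z‖) / 2)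
    ⟨by linarith [hw.1], by linarith [hw.2]⟩ (by linarith)
  calc star ω z ≤ 2 * (1 - ‖z‖) * (tail ω ‖z‖).toReal := h1
    _ ≤ 2 * (a * (1 - ‖φ z‖)) * (C * (tail ω ((1 + ‖φ z‖) / 2)).toReal) := by
        have := sub_pos.2 (mem_disc.1 hz)
        have := sub_pos.2 hw.2
        gcongr
    _ = 4 * a * C * ((1 - ‖φ z‖) / 2 * (tail ω ((1 + ‖φ z‖) / 2)).toReal) := by ring
    _ ≤ _ := by gcongr

end SchwarzPick

/-! ### Parseval's identity on circles -/

section Parseval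

theorem integral_circleMap_pow_mul_conj (s : ℝ) (n m : ℕ) :
    ∫ θ in -Real.pi..Real.pi, circleMap 0 s θ ^ n * conj (circleMap 0 s θ ^ m) =
      if n = m then ((2 * Real.pi * s ^ (2 * n) : ℝ) : ℂ) else 0 := by
  have h : ∀ θ : ℝ, circleMap 0 s θ ^ n * conj (circleMap 0 s θ ^ m) =
      (s : ℂ) ^ (n + m) * Complex.exp ((((n : ℂ) - m) * Complex.I) * θ) := by
    intro θ
    simp only [circleMap, zero_add, map_pow, map_mul, Complex.conj_ofReal, mul_pow,
      ← Complex.exp_conj, Complex.conj_I, ← Complex.exp_nat_mul, pow_add]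
    rw [mul_mul_mul_comm, ← Complex.exp_add]
    congr 2
    rw [map_natCast]
    ring
  simp_rw [h]
  rw [intervalIntegral.integral_const_mul]
  split_ifs with hnm
  · subst hnm
    simp
    ring
  · have hc : ((n : ℂ) - m) * Complex.I ≠ 0 :=
      mul_ne_zero (sub_ne_zero.2 (by exact_mod_cast hnm)) Complex.I_ne_zero
    rw [integral_exp_mul_complex hc]
    have : Complex.exp ((((n : ℂ) - m) * Complex.I) * Real.pi) =
        Complex.exp ((((n : ℂ) - m) * Complex.I) * (-Real.pi : ℝ)) := by
      rw [Complex.exp_eq_exp_iff_exists_int]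
      refine ⟨(n : ℤ) - m, ?_⟩
      push_cast
      ring
    rw [this, sub_self, zero_div, mul_zero]

theorem integral_norm_sum_pow_sq (A : Finset ℕ) (c : ℕ → ℂ) (s : ℝ) :
    ∫ θ in -Real.pi..Real.pi, ‖∑ n ∈ A, c n * circleMap 0 s θ ^ n‖ ^ 2 =
      2 * Real.pi * ∑ n ∈ A, ‖c n‖ ^ 2 * s ^ (2 * n) := by
  rw [← Complex.ofReal_inj, ← intervalIntegral.integral_ofReal]
  have h : ∀ θ : ℝ, ((‖∑ n ∈ A, c n * circleMap 0 s θ ^ n‖ ^ 2 : ℝ) : ℂ) =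
      ∑ n ∈ A, ∑ m ∈ A, (c n * conj (c m)) *
        (circleMap 0 s θ ^ n * conj (circleMap 0 s θ ^ m)) := by
    intro θ
    rw [Complex.ofReal_pow, ← Complex.mul_conj', map_sum, Finset.sum_mul_sum]
    refine Finset.sum_congr rfl fun n _ => Finset.sum_congr rfl fun m _ => ?_
    rw [map_mul]
    ring
  simp_rw [h]
  have hint : ∀ n m : ℕ, IntervalIntegrable (fun θ : ℝ => (c n * conj (c m)) *
        (circleMap 0 s θ ^ n * conj (circleMap 0 s θ ^ m))) volume (-Real.pi) Real.pi := by
    intro n m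
    refine Continuous.intervalIntegrable ?_ _ _
    have := continuous_circleMap 0 s
    have hc := Complex.continuous_conj
    exact continuous_const.mul ((this.pow n).mul (hc.comp (this.pow m)))
  rw [intervalIntegral.integral_finsetSum fun n _ => by
    have := IntervalIntegrable.sum A (fun m _ => hint n m)
    simpa [Finset.sum_fn] using this]
  simp_rw [intervalIntegral.integral_finsetSum fun m _ => hint _ m,
    intervalIntegral.integral_const_mul, integral_circleMap_pow_mul_conj]
  push_cast
  rw [Finset.mul_sum]
  refine Finset.sum_congr rfl fun n hn => ?_
  simp only [mul_ite, mul_zero, Finset.sum_ite_eq, hn, if_true, Complex.mul_conj']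
  ring

end Parseval

end WeightedBergman

namespace WeightedBergman

open Filter Topology ComplexConjugate

/-! ### Two-sided estimates of the kernel norms -/

section Kernel

variable {ω : ℂ → ℝ}

/-- Point evaluation is applied to `K z` itself, whose value at z is ‖K_z‖². -/
theorem kernel_norm_sq_mul_evalConst_le (hω : IsDoubling ω) {K : ℂ → bergmanSpace ω}
    (hK : ∀ z ∈ disc, ∀ f, inner ℂ (K z) f = rep f z) {z : ℂ} (hz : z ∈ disc) :
    ‖K z‖ ^ 2 * evalConst ω ‖z‖ ≤ 1 := by
  have h1 := hω.norm_sq_rep_le (K z) hz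
  rw [← hK z hz, inner_self_eq_ofReal, Complex.norm_real, Real.norm_of_nonneg (by positivity)] at h1
  rcases (norm_nonneg (K z)).eq_or_lt with h0 | h0
  · simp [← h0]
  · have : 0 < ‖K z‖ ^ 2 := by positivity
    refine le_of_mul_le_mul_left ?_ this
    nlinarith

theorem exists_kernel_norm_sq_le (hω : IsDoubling ω) {K : ℂ → bergmanSpace ω}
    (hK : ∀ z ∈ disc, ∀ f, inner ℂ (K z) f = rep f z) {ρ : ℝ} (hρ : ρ ∈ Ico (0 : ℝ) 1) :
    ∃ C > 0, ∀ z, ‖z‖ ≤ ρ → ‖K z‖ ^ 2 ≤ C := by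
  have hc := hω.evalConst_pos hρ
  refine ⟨(evalConst ω ρ)⁻¹, inv_pos.2 hc, fun z hz => ?_⟩
  have h1 := kernel_norm_sq_mul_evalConst_le hω hK (mem_disc.2 (hz.trans_lt hρ.2))
  have h2 := hω.evalConst_anti (norm_nonneg z) hz hρ.2.le
  rw [← one_div, le_div_iff₀ hc]
  exact (mul_le_mul_of_nonneg_left h2 (sq_nonneg _)).trans h1

theorem exists_kernel_norm_sq_mul_star_le (hω : IsDoubling ω) {K : ℂ → bergmanSpace ω}
    (hK : ∀ z ∈ disc, ∀ f, inner ℂ (K z) f = rep f z) :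
    ∃ C > 0, ∀ z ∈ disc, 1 / 2 ≤ ‖z‖ → ‖K z‖ ^ 2 * star ω z ≤ C := by
  obtain ⟨C, hC, htail⟩ := hω.exists_toReal_tail_le 2
  refine ⟨2 * C, by positivity, fun z hz hz2 => ?_⟩
  have hr := norm_mem_Ico hz
  have h1 := htail ‖z‖ hr ((1 + ‖z‖) / 2) ⟨by linarith [hr.1], by linarith [hr.2]⟩ (by linarith)
  have h2 : star ω z ≤ 2 * C * evalConst ω ‖z‖ := by
    refine (hω.star_le hz hz2).trans ?_
    rw [evalConst]
    have := mul_le_mul_of_nonneg_left h1 (by linarith [hr.2] : 0 ≤ 2 * (1 - ‖z‖))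
    linarith
  have h3 := kernel_norm_sq_mul_evalConst_le hω hK hz
  calc ‖K z‖ ^ 2 * star ω z ≤ ‖K z‖ ^ 2 * (2 * C * evalConst ω ‖z‖) := by gcongr
    _ = 2 * C * (‖K z‖ ^ 2 * evalConst ω ‖z‖) := by ring
    _ ≤ 2 * C * 1 := by gcongr
    _ = 2 * C := mul_one _

theorem star_le_two_mul_tail (hω : IsDoubling ω) {z : ℂ} (hz : z ∈ disc) (hz2 : 1 / 2 ≤ ‖z‖) :
    star ω z ≤ 2 * (tail ω 0).toReal := by
  refine (hω.star_le hz hz2).trans ?_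
  have h1 := hω.toReal_tail_anti le_rfl (norm_nonneg z)
  have h2 : (0 : ℝ) ≤ (tail ω ‖z‖).toReal := ENNReal.toReal_nonneg
  have h3 := mem_disc.1 hz
  nlinarith

/-- The kernels of the subspace of functions vanishing at the origin. -/
theorem exists_kernel_sub_norm_sq_mul_star_le (hω : IsDoubling ω) {K : ℂ → bergmanSpace ω}
    (hK : ∀ z ∈ disc, ∀ f, inner ℂ (K z) f = rep f z) :
    ∃ C > 0, ∀ z ∈ disc, ‖K z - K 0‖ ^ 2 * star ω z ≤ C := by
  obtain ⟨C₁, hC₁, h₁⟩ := exists_kernel_norm_sq_mul_star_le hω hK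
  obtain ⟨C₂, hC₂, h₂⟩ := exists_kernel_norm_sq_le hω hK (ρ := 3 / 4) (by norm_num)
  set t := (tail ω 0).toReal with ht
  have ht0 : 0 ≤ t := ENNReal.toReal_nonneg
  have h0 : (0 : ℂ) ∈ disc := by simp [disc]
  refine ⟨2 * C₁ + 4 * C₂ * t + 8 * C₂ * t, by positivity, fun z hz => ?_⟩
  rcases le_total (1 / 2) ‖z‖ with hz2 | hz2
  · have h3 := h₁ z hz hz2
    have h4 := h₂ 0 (by norm_num)
    have h5 := star_le_two_mul_tail hω hz hz2
    have h6 : ‖K z - K 0‖ ^ 2 ≤ 2 * ‖K z‖ ^ 2 + 2 * ‖K 0‖ ^ 2 := by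
      have := norm_sub_le (K z) (K 0)
      have := pow_le_pow_left₀ (norm_nonneg _) this 2
      nlinarith [sq_nonneg (‖K z‖ - ‖K 0‖)]
    have hs := hω.star_nonneg hz
    have h7 := mul_le_mul_of_nonneg_right h6 hs
    have h8 : ‖K 0‖ ^ 2 * star ω z ≤ C₂ * (2 * t) := by gcongr
    have h9 : 0 ≤ C₂ * t := by positivity
    nlinarith
  · rcases eq_or_ne z 0 with rfl | hz0
    · simp
      positivity
    -- Here ‖f‖² = f(z) - f(0). Since |f| ≤ M on |w| < 3/4, the Schwarz lemma bounds this by (2M /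
    -- (3/4)) |z| with M proportional to ‖f‖, so ‖f‖ = O(|z|). This absorbs the logarithm in ω⋆,
    -- bounded crudely by 1/|z|.
    set f := K z - K 0 with hf
    set M := √C₂ * ‖f‖ with hM
    have hbd : ∀ w, ‖w‖ ≤ 3 / 4 → ‖rep f w‖ ≤ M := by
      intro w hw
      rw [← hK w (mem_disc.2 (by linarith))]
      refine (norm_inner_le_norm (𝕜 := ℂ) (K w) f).trans ?_
      rw [hM]
      gcongr
      exact Real.le_sqrt_of_sq_le (h₂ w hw)
    have hmaps : MapsTo (rep f) (Metric.ball 0 (3 / 4)) (Metric.closedBall (rep f 0) (2 * M)) := by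
      intro w hw
      rw [mem_closedBall_iff_norm]
      have h1 := hbd w (by simpa using (mem_ball_zero_iff.1 hw).le)
      have h2 := hbd 0 (by norm_num)
      linarith [norm_sub_le (rep f w) (rep f 0)]
    have h3 := Complex.dist_le_div_mul_dist_of_mapsTo_ball ((rep_differentiableOn f).mono
      (Metric.ball_subset_ball (by norm_num))) hmaps (z := z)
      (mem_ball_zero_iff.2 (by linarith : ‖z‖ < 3 / 4))
    rw [dist_eq_norm, dist_zero_right] at h3
    have h4 : ‖f‖ ^ 2 = ‖rep f z - rep f 0‖ := by
      have h5 : inner ℂ f f = inner ℂ (K z) f - inner ℂ (K 0) f := inner_sub_left _ _ _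
      rw [← hK z hz, ← hK 0 h0, ← h5, inner_self_eq_ofReal, Complex.norm_real,
        Real.norm_of_nonneg (by positivity)]
    rw [← h4, hM] at h3
    have h5 : ‖f‖ ≤ 8 / 3 * √C₂ * ‖z‖ := by
      rcases (norm_nonneg f).eq_or_lt with h | h
      · rw [← h]; positivity
      · refine le_of_mul_le_mul_left ?_ h
        nlinarith
    have h6 : ‖f‖ ^ 2 ≤ 8 * C₂ * ‖z‖ := by
      have h7 := pow_le_pow_left₀ (norm_nonneg f) h5 2
      rw [mul_pow, mul_pow, Real.sq_sqrt hC₂.le] at h7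
      have h8 : ‖z‖ ^ 2 ≤ ‖z‖ / 2 := by nlinarith [norm_nonneg z]
      have h9 := mul_le_mul_of_nonneg_left h8 hC₂.le
      have h10 : 0 ≤ C₂ * ‖z‖ := by positivity
      nlinarith
    have hz1 : 0 < ‖z‖ := norm_pos_iff.2 hz0
    have h7 : star ω z ≤ ‖z‖⁻¹ * t := by
      refine (hω.star_le_log hz hz0).trans ?_
      gcongr
      rw [one_div]
      have := Real.log_le_sub_one_of_pos (inv_pos.2 hz1)
      linarith
    have hs0 := hω.star_nonneg hz
    calc ‖f‖ ^ 2 * star ω z ≤ (8 * C₂ * ‖z‖) * (‖z‖⁻¹ * t) := by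
          gcongr
      _ = 8 * C₂ * t := by field_simp
      _ ≤ _ := by
          have : 0 ≤ 4 * C₂ * t := by positivity
          linarith

/-- Parseval on each circle gives s^(2n), and the Jacobian supplies one more power of s; hence 2n +
1 in the hypothesis. -/
theorem lintegral_norm_sum_pow_sq_le (hω : IsRadialWeight ω) {N : ℕ} {A : Finset ℕ}
    (hA : ∀ n ∈ A, N ≤ 2 * n + 1) (c : ℕ → ℂ) :
    ∫⁻ z, ‖∑ n ∈ A, c n * z ^ n‖ₑ ^ 2 ∂weightedArea ω ≤
      2 * ENNReal.ofReal (∑ n ∈ A, ‖c n‖ ^ 2) * ∫⁻ s in Ioo (0 : ℝ) 1,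
        ENNReal.ofReal (ω s) * ENNReal.ofReal (s ^ N) := by
  rw [lintegral_weightedArea_polar hω (aemeasurable_enorm_sq (Continuous.continuousOn
    (by fun_prop))), ← lintegral_const_mul' _ _ (by simp [Real.pi_pos]),
    ← lintegral_const_mul' (2 * ENNReal.ofReal (∑ n ∈ A, ‖c n‖ ^ 2)) _ (by finiteness)]
  refine setLIntegral_mono' measurableSet_Ioo fun s hs => ?_
  simp_rw [← ofReal_norm_sq]
  rw [lintegral_angle_eq_ofReal (g := fun w => ‖∑ n ∈ A, c n * w ^ n‖ ^ 2)
    (by have := continuous_circleMap 0 s; fun_prop) (fun _ => sq_nonneg _),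
    integral_norm_sum_pow_sq, mul_left_comm, mul_left_comm (2 * _)]
  refine mul_le_mul_right ?_ _
  rw [← ENNReal.ofReal_mul hs.1.le, ← ENNReal.ofReal_inv_of_pos Real.pi_pos,
    ← ENNReal.ofReal_mul (by positivity), ← ENNReal.ofReal_ofNat 2, ← ENNReal.ofReal_mul
    (by norm_num), ← ENNReal.ofReal_mul (by positivity)]
  refine ENNReal.ofReal_le_ofReal ?_
  have h1 : s * ∑ n ∈ A, ‖c n‖ ^ 2 * s ^ (2 * n) ≤ (∑ n ∈ A, ‖c n‖ ^ 2) * s ^ N := by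
    rw [Finset.mul_sum, Finset.sum_mul]
    refine Finset.sum_le_sum fun n hn => ?_
    rw [mul_left_comm, ← pow_succ']
    exact mul_le_mul_of_nonneg_left (pow_le_pow_of_le_one hs.1.le hs.2.le (hA n hn))
      (sq_nonneg _)
  calc _ = 2 * (s * ∑ n ∈ A, ‖c n‖ ^ 2 * s ^ (2 * n)) := by
        have := Real.pi_pos
        field_simp
    _ ≤ _ := by linarith

theorem exp_le_pow_of_half_le {r : ℝ} (hr : 1 / 2 ≤ r) (hr1 : r < 1) {k : ℕ}
    (hk : (k : ℝ) ≤ 8 / (1 - r)) : Real.exp (-16) ≤ r ^ k := by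
  have hr0 : 0 < r := by linarith
  have h1 : 0 < 1 - r := by linarith
  rw [← Real.exp_log hr0, ← Real.exp_nat_mul]
  refine Real.exp_le_exp.2 ?_
  have h2 := Real.one_sub_inv_le_log_of_pos hr0
  have h3 : -(2 * (1 - r)) ≤ 1 - r⁻¹ := by
    have : r⁻¹ * r = 1 := inv_mul_cancel₀ hr0.ne'
    have h4 : 0 < r⁻¹ := inv_pos.2 hr0
    nlinarith
  have h5 := mul_le_mul_of_nonneg_right hk (by linarith : 0 ≤ 2 * (1 - r))
  have h6 : 8 / (1 - r) * (2 * (1 - r)) = 16 := by field_simp; norm_num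
  have h7 := mul_le_mul_of_nonneg_left (h3.trans h2) (Nat.cast_nonneg (α := ℝ) k)
  linarith

/-- The test functions that bound the kernels from below. -/
theorem exists_le_kernel_norm_sq_of_half_le (hω : IsDoubling ω) {K : ℂ → bergmanSpace ω}
    (hK : ∀ z ∈ disc, ∀ f, inner ℂ (K z) f = rep f z) :
    ∃ c > 0, ∀ z ∈ disc, 1 / 2 ≤ ‖z‖ →
      c ≤ ‖K z‖ ^ 2 * ((1 - ‖z‖) * (tail ω ‖z‖).toReal) := by
  obtain ⟨C, hC⟩ := hω.exists_lintegral_exp_le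
  refine ⟨Real.exp (-16) / (2 * (C + 1)), by positivity, fun z hz hz2 => ?_⟩
  set r := ‖z‖ with hr
  have hr1 : r < 1 := mem_disc.1 hz
  have hx : 0 < 1 - r := by linarith
  set t := (tail ω r).toReal with ht
  have ht0 : 0 < t := hω.toReal_tail_pos (norm_mem_Ico hz)
  -- The test function is a block of the Szegő kernel, with exponents in [N, 2N) and N of order
  -- 1/(1-r). The exponents are small enough for r^(2n) ≥ e^(-16), since 2n ≤ 4N ≤ 8/(1-r), and
  -- large enough for s^N ≤ exp(-(1-s)/(1-r)), whose integral is O(ω̂(r)). So F(z) = S with S ≥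
  -- e^(-16)/(1-r), while ‖F‖² ≤ 2 S C ω̂(r).
  set N := ⌈1 / (1 - r)⌉₊ with hN
  have hN1 : 1 / (1 - r) ≤ N := Nat.le_ceil _
  have hN2 : (N : ℝ) ≤ 2 / (1 - r) := by
    have h1 : (N : ℝ) < 1 / (1 - r) + 1 := Nat.ceil_lt_add_one (by positivity)
    have h2 : 1 ≤ 1 / (1 - r) := by rw [one_le_div hx]; linarith
    have h3 : 2 / (1 - r) = 1 / (1 - r) + 1 / (1 - r) := by ring
    linarith
  set A := Finset.Ico N (2 * N) with hA
  set F : ℂ → ℂ := fun w => ∑ n ∈ A, conj z ^ n * w ^ n with hF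
  set S : ℝ := ∑ n ∈ A, r ^ (2 * n) with hS
  have hSsum : ∑ n ∈ A, ‖conj z ^ n‖ ^ 2 = S := by
    refine Finset.sum_congr rfl fun n _ => ?_
    rw [norm_pow, Complex.norm_conj, ← pow_mul, mul_comm]
  have hSle : Real.exp (-16) / (1 - r) ≤ S := by
    have h1 : ∀ n ∈ A, Real.exp (-16) ≤ r ^ (2 * n) := by
      intro n hn
      refine exp_le_pow_of_half_le hz2 hr1 ?_
      have h2 : (n : ℝ) ≤ 2 * N := by exact_mod_cast (Finset.mem_Ico.1 hn).2.le
      have h3 : 8 / (1 - r) = 4 * (2 / (1 - r)) := by ring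
      push_cast
      linarith
    have h2 := Finset.card_nsmul_le_sum A _ _ h1
    have h3 : A.card = N := by rw [hA, Nat.card_Ico]; omega
    rw [h3, nsmul_eq_mul] at h2
    refine le_trans ?_ h2
    rw [div_eq_mul_one_div, mul_comm]
    gcongr
  have hS0 : 0 < S := lt_of_lt_of_le (by positivity) hSle
  have hint : ∫⁻ w, ‖F w‖ₑ ^ 2 ∂weightedArea ω ≤ ENNReal.ofReal (2 * S * (C * t)) := by
    refine (lintegral_norm_sum_pow_sq_le hω.weight (N := N) (fun n hn => by
      have := (Finset.mem_Ico.1 hn).1; omega) _).trans ?_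
    rw [hSsum, ENNReal.ofReal_mul (by positivity), ENNReal.ofReal_mul (by norm_num),
      ENNReal.ofReal_ofNat, ENNReal.ofReal_mul (by positivity), ENNReal.ofReal_coe_nnreal, ht,
      ENNReal.ofReal_toReal (hω.tail_lt_top (norm_nonneg z)).ne]
    gcongr
    refine (setLIntegral_mono' measurableSet_Ioo fun s hs => ?_).trans (hC r (norm_mem_Ico hz))
    gcongr
    have h1 : s ≤ Real.exp (-(1 - s)) := by linarith [Real.add_one_le_exp (-(1 - s))]
    refine (pow_le_pow_left₀ hs.1.le h1 N).trans ?_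
    rw [← Real.exp_nat_mul]
    refine Real.exp_le_exp.2 ?_
    have := mul_le_mul_of_nonneg_right hN1 (by linarith [hs.2] : 0 ≤ 1 - s)
    rw [div_mul_eq_mul_div, one_mul] at this
    linarith
  have hFd : DifferentiableOn ℂ F disc := by
    refine Differentiable.differentiableOn ?_
    fun_prop
  obtain ⟨f, hf⟩ := exists_bergmanSpace_of_lintegral_lt_top hFd
    (hint.trans_lt ENNReal.ofReal_lt_top)
  have hfn : ‖f‖ ^ 2 ≤ 2 * S * (C * t) := by
    have h : ‖f‖ ^ 2 = _ := norm_sq_eq_toReal _ hf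
    rw [h]
    exact ENNReal.toReal_le_of_le_ofReal (by positivity) hint
  have hFz : F z = S := by
    rw [hF, hS]
    push_cast
    refine Finset.sum_congr rfl fun n _ => ?_
    rw [← mul_pow, Complex.conj_mul', ← hr, ← pow_mul]
  have h1 : S ≤ ‖K z‖ * ‖f‖ := by
    have := norm_inner_le_norm (𝕜 := ℂ) (K z) f
    rwa [hK z hz, hω.rep_eq hFd hf hz, hFz, Complex.norm_real, Real.norm_of_nonneg hS0.le] at this
  have h2 : S ^ 2 ≤ ‖K z‖ ^ 2 * (2 * S * (C * t)) := by
    calc S ^ 2 ≤ (‖K z‖ * ‖f‖) ^ 2 := by gcongr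
      _ = ‖K z‖ ^ 2 * ‖f‖ ^ 2 := mul_pow _ _ _
      _ ≤ _ := by gcongr
  have h3 : S ≤ ‖K z‖ ^ 2 * (2 * (C * t)) := by
    refine le_of_mul_le_mul_left ?_ hS0
    linarith
  have h4 := hSle.trans h3
  rw [div_le_iff₀ hx] at h4
  rw [div_le_iff₀ (by positivity)]
  refine h4.trans ?_
  have : 0 ≤ ‖K z‖ ^ 2 * t * (1 - r) := by positivity
  nlinarith

/-- The test function is the constant 1; this covers the centre of the disc. -/
theorem exists_le_kernel_norm_sq (hω : IsDoubling ω) {K : ℂ → bergmanSpace ω}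
    (hK : ∀ z ∈ disc, ∀ f, inner ℂ (K z) f = rep f z) :
    ∃ c > 0, ∀ z ∈ disc, c ≤ ‖K z‖ ^ 2 := by
  have := hω.isFiniteMeasure_weightedArea
  obtain ⟨f, hf⟩ := exists_bergmanSpace_of_lintegral_lt_top (ω := ω) (F := fun _ => 1)
    (differentiableOn_const 1) (by simp)
  refine ⟨(‖f‖ ^ 2 + 1)⁻¹, by positivity, fun z hz => ?_⟩
  have h1 := norm_inner_le_norm (𝕜 := ℂ) (K z) f
  rw [hK z hz, hω.rep_eq (differentiableOn_const 1) hf hz, norm_one] at h1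
  have h2 := pow_le_pow_left₀ zero_le_one h1 2
  rw [one_pow, mul_pow] at h2
  rw [← one_div, div_le_iff₀ (by positivity)]
  nlinarith [sq_nonneg ‖K z‖]

theorem exists_le_kernel_norm_sq_mul_star (hω : IsDoubling ω) {K : ℂ → bergmanSpace ω}
    (hK : ∀ z ∈ disc, ∀ f, inner ℂ (K z) f = rep f z) :
    ∃ c > 0, ∀ z ∈ disc, z ≠ 0 → c ≤ ‖K z‖ ^ 2 * star ω z := by
  obtain ⟨c₁, hc₁, h₁⟩ := exists_le_kernel_norm_sq_of_half_le hω hK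
  obtain ⟨c₂, hc₂, h₂⟩ := exists_le_kernel_norm_sq hω hK
  obtain ⟨C, hC, htail⟩ := hω.exists_toReal_tail_le 2
  have ht : 0 < (tail ω (3 / 4)).toReal := hω.toReal_tail_pos (by norm_num)
  refine ⟨min (c₁ / (2 * C)) (c₂ * (1 / 4 * (tail ω (3 / 4)).toReal)), by positivity,
    fun z hz h0 => ?_⟩
  have hr := norm_mem_Ico hz
  have hs := hω.le_star hz h0
  rcases le_total (1 / 2) ‖z‖ with hz2 | hz2
  · refine (min_le_left _ _).trans ?_
    have h3 := htail ‖z‖ hr ((1 + ‖z‖) / 2) ⟨by linarith [hr.1], by linarith [hr.2]⟩ (by linarith)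
    rw [div_le_iff₀ (by positivity)]
    have h4 : (1 - ‖z‖) * (tail ω ‖z‖).toReal ≤ star ω z * (2 * C) := by
      have := mul_le_mul_of_nonneg_left h3 (by linarith [hr.2] : 0 ≤ 1 - ‖z‖)
      have := mul_le_mul_of_nonneg_left hs (by linarith : 0 ≤ 2 * C)
      linarith
    rw [mul_assoc]
    exact (h₁ z hz hz2).trans (by gcongr)
  · refine (min_le_right _ _).trans ?_
    have h3 := hω.toReal_tail_anti (r := (1 + ‖z‖) / 2) (s := 3 / 4) (by linarith [hr.1])
      (by linarith)
    have h4 : 1 / 4 * (tail ω (3 / 4)).toReal ≤ star ω z :=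
      le_trans (mul_le_mul (by linarith) h3 ht.le (by linarith)) hs
    have := h₂ z hz
    gcongr

end Kernel

end WeightedBergman

namespace WeightedBergman

open Filter Topology ContinuousLinearMap

/-! ### Jensen's inequality with weights -/

section WeightedMeans

/-- Jensen's inequality for the weights `w` and the concave power `q`. -/
theorem sum_mul_rpow_le {ι : Type*} (F : Finset ι) {w l : ι → ℝ} (hw : ∀ i, 0 ≤ w i)
    (hl : ∀ i, 0 ≤ l i) {q : ℝ} (hq : 0 < q) (hq1 : q ≤ 1) :
    ∑ i ∈ F, w i * l i ^ q ≤ (∑ i ∈ F, w i) ^ (1 - q) * (∑ i ∈ F, w i * l i) ^ q := by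
  have h := Real.inner_le_weight_mul_Lp_of_nonneg F (p := q⁻¹) ((one_le_inv₀ hq).2 hq1) w
    (fun i => l i ^ q) hw (fun i => Real.rpow_nonneg (hl i) q)
  simp only [inv_inv] at h
  simpa only [← Real.rpow_mul (hl _), mul_inv_cancel₀ hq.ne', Real.rpow_one] using h

/-- Jensen's inequality for the weights `w` and the convex power `q`. -/
theorem rpow_sum_mul_le {ι : Type*} (F : Finset ι) {w l : ι → ℝ} (hw : ∀ i, 0 ≤ w i)
    (hl : ∀ i, 0 ≤ l i) {q : ℝ} (hq : 1 ≤ q) :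
    (∑ i ∈ F, w i * l i) ^ q ≤ (∑ i ∈ F, w i) ^ (q - 1) * ∑ i ∈ F, w i * l i ^ q := by
  have hq0 : 0 < q := by linarith
  have h := Real.inner_le_weight_mul_Lp_of_nonneg F (p := q) hq w l hw hl
  have h0 : 0 ≤ ∑ i ∈ F, w i := Finset.sum_nonneg fun i _ => hw i
  have h1 : 0 ≤ ∑ i ∈ F, w i * l i ^ q :=
    Finset.sum_nonneg fun i _ => mul_nonneg (hw i) (Real.rpow_nonneg (hl i) q)
  refine (Real.rpow_le_rpow (Finset.sum_nonneg fun i _ => mul_nonneg (hw i) (hl i)) h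
    hq0.le).trans_eq ?_
  rw [Real.mul_rpow (Real.rpow_nonneg h0 _) (Real.rpow_nonneg h1 _), ← Real.rpow_mul h0,
    ← Real.rpow_mul h1, inv_mul_cancel₀ hq0.ne', Real.rpow_one, sub_mul, one_mul,
    inv_mul_cancel₀ hq0.ne']

/-- From log x ≤ x^ε/ε with ε = 1/(q+1), which keeps εq ≤ 1. With x = 1/|z| it tames the powers of
ω⋆ near the origin. -/
theorem rpow_log_le {q x : ℝ} (hq : 0 ≤ q) (hx : 1 ≤ x) :
    Real.log x ^ q ≤ (q + 1) ^ q * x := by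
  have h1 := Real.log_le_rpow_div (x := x) (by linarith) (ε := 1 / (q + 1)) (by positivity)
  refine (Real.rpow_le_rpow (Real.log_nonneg hx) h1 hq).trans ?_
  have h2 : x ^ (1 / (q + 1)) / (1 / (q + 1)) = (q + 1) * x ^ (1 / (q + 1)) := by
    field_simp
  rw [h2, Real.mul_rpow (by positivity) (by positivity), ← Real.rpow_mul (by linarith)]
  gcongr
  refine (Real.rpow_le_rpow_of_exponent_le hx (y := 1 / (q + 1) * q) (z := 1) ?_).trans_eq
    (Real.rpow_one x)
  rw [one_div_mul_eq_div, div_le_one (by positivity)]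
  linarith

end WeightedMeans

/-! ### Schatten criteria for operators given by a family of vectors -/

section KernelOperators

variable {ω : ℂ → ℝ}

theorem ae_area_mem_disc : ∀ᵐ z ∂area, z ∈ disc :=
  Measure.ae_smul_measure (ae_restrict_mem measurableSet_disc) _

theorem ae_weightedArea_mem_disc : ∀ᵐ z ∂weightedArea ω, z ∈ disc :=
  weightedArea_absolutelyContinuous.ae_le ae_area_mem_disc

theorem ext_rep {f g : bergmanSpace ω} (h : ∀ z ∈ disc, rep f z = rep g z) : f = g := by
  refine Subtype.ext (Lp.ext ?_)
  filter_upwards [coe_ae_eq_rep f, coe_ae_eq_rep g, ae_weightedArea_mem_disc] with z h1 h2 h3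
  rw [h1, h2, h z h3]

theorem enorm_sq_eq_lintegral_rep (f : bergmanSpace ω) :
    ‖f‖ₑ ^ 2 = ∫⁻ z, ‖rep f z‖ₑ ^ 2 ∂weightedArea ω :=
  enorm_sq_eq_lintegral _ (coe_ae_eq_rep f)

theorem aemeasurable_enorm_sq_rep (f : bergmanSpace ω) :
    AEMeasurable (fun z => ‖rep f z‖ₑ ^ 2) area :=
  aemeasurable_enorm_sq (rep_differentiableOn f).continuousOn

/-- A square integrable family `κ` of vectors with analytic pairings defines a bounded operator
whose value at `f` is the function `z ↦ ⟪κ z, f⟫`. -/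
theorem exists_operator_of_kernel (hω : IsDoubling ω) {κ : ℂ → bergmanSpace ω}
    (hκ : ∀ f, DifferentiableOn ℂ (fun z => inner ℂ (κ z) f) disc)
    (hfin : ∫⁻ z, ENNReal.ofReal (ω z) * ‖κ z‖ₑ ^ 2 ∂area < ⊤) :
    ∃ T : bergmanSpace ω →L[ℂ] bergmanSpace ω, ∀ f, ∀ z ∈ disc, rep (T f) z = inner ℂ (κ z) f := by
  set M := ∫⁻ z, ENNReal.ofReal (ω z) * ‖κ z‖ₑ ^ 2 ∂area with hM
  have hbd : ∀ f : bergmanSpace ω,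
      ∫⁻ z, ‖(inner ℂ (κ z) f : ℂ)‖ₑ ^ 2 ∂weightedArea ω ≤ M * ‖f‖ₑ ^ 2 := by
    intro f
    rw [lintegral_weightedArea hω.weight (aemeasurable_enorm_sq (hκ f).continuousOn), hM,
      ← lintegral_mul_const' _ _ (by finiteness)]
    refine lintegral_mono fun z => ?_
    rw [mul_assoc, ← mul_pow]
    gcongr
    rw [← ofReal_norm, ← ofReal_norm, ← ofReal_norm, ← ENNReal.ofReal_mul (norm_nonneg _)]
    exact ENNReal.ofReal_le_ofReal (norm_inner_le_norm (𝕜 := ℂ) (κ z) f)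
  choose T₀ hT₀ using fun f => exists_bergmanSpace_of_lintegral_lt_top (hκ f)
    ((hbd f).trans_lt (by finiteness))
  have hrep : ∀ f, ∀ z ∈ disc, rep (T₀ f) z = inner ℂ (κ z) f :=
    fun f z hz => hω.rep_eq (hκ f) (hT₀ f) hz
  let L : bergmanSpace ω →ₗ[ℂ] bergmanSpace ω :=
    { toFun := T₀
      map_add' := fun f g => ext_rep fun z hz => by
        rw [hrep _ z hz, hω.rep_add _ _ hz, hrep _ z hz, hrep _ z hz, inner_add_right]
      map_smul' := fun c f => ext_rep fun z hz => by
        rw [hrep _ z hz, RingHom.id_apply, hω.rep_smul _ _ hz, hrep _ z hz, inner_smul_right] }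
  refine ⟨L.mkContinuous √M.toReal fun f => ?_, hrep⟩
  have h1 : ‖T₀ f‖ₑ ^ 2 ≤ M * ‖f‖ₑ ^ 2 := (enorm_sq_eq_lintegral _ (hT₀ f)).trans_le (hbd f)
  have h2 := ENNReal.toReal_mono (by finiteness) h1
  rw [ENNReal.toReal_mul, ENNReal.toReal_pow, ENNReal.toReal_pow, toReal_enorm, toReal_enorm] at h2
  refine (abs_le_of_sq_le_sq' ?_ (by positivity)).2
  rwa [mul_pow, Real.sq_sqrt ENNReal.toReal_nonneg]

theorem aemeasurable_weight_mul_enorm_sq_rep (hω : IsRadialWeight ω) (f : bergmanSpace ω) :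
    AEMeasurable (fun z => ENNReal.ofReal (ω z) * ‖rep f z‖ₑ ^ 2) area :=
  hω.aemeasurable_ofReal.mul (aemeasurable_enorm_sq_rep f)

theorem lintegral_weight_mul_enorm_sq_rep (hω : IsRadialWeight ω) (f : bergmanSpace ω) :
    ∫⁻ z, ENNReal.ofReal (ω z) * ‖rep f z‖ₑ ^ 2 ∂area = ‖f‖ₑ ^ 2 := by
  rw [enorm_sq_eq_lintegral_rep, lintegral_weightedArea hω (aemeasurable_enorm_sq_rep _)]

theorem norm_rep_sq {K : ℂ → bergmanSpace ω} (hK : ∀ z ∈ disc, ∀ f, inner ℂ (K z) f = rep f z)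
    {z : ℂ} (hz : z ∈ disc) (f : bergmanSpace ω) :
    ‖rep f z‖ₑ ^ 2 = ENNReal.ofReal (‖inner ℂ f (K z)‖ ^ 2) := by
  rw [← hK z hz, ← ofReal_norm_sq]
  exact congrArg (fun t : ℝ => ENNReal.ofReal (t ^ 2)) (norm_inner_symm (𝕜 := ℂ) (K z) f)

/-- Bessel's inequality for κ(z), integrated against ω dA, bounds the Hilbert–Schmidt sums. -/
theorem isCompactOperator_of_kernel (hω : IsDoubling ω) {κ : ℂ → bergmanSpace ω}
    (hfin : ∫⁻ z, ENNReal.ofReal (ω z) * ‖κ z‖ₑ ^ 2 ∂area < ⊤)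
    {T : bergmanSpace ω →L[ℂ] bergmanSpace ω}
    (hT : ∀ f, ∀ z ∈ disc, rep (T f) z = inner ℂ (κ z) f) : IsCompactOperator T := by
  have := hω.completeSpace
  refine isCompactOperator_of_sum_norm_sq_le
    (M := (∫⁻ z, ENNReal.ofReal (ω z) * ‖κ z‖ₑ ^ 2 ∂area).toReal) fun s h1 h2 => ?_
  have hs : Orthonormal ℂ fun x : s => (x : bergmanSpace ω) :=
    ⟨fun x => h1 x x.2, fun x y hxy => h2 x x.2 y y.2 (Subtype.coe_injective.ne hxy)⟩
  rw [← ENNReal.ofReal_le_iff_le_toReal hfin.ne, ENNReal.ofReal_sum_of_nonneg fun x _ =>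
    sq_nonneg _]
  have h3 : ∀ x ∈ s, ENNReal.ofReal (‖T x‖ ^ 2) =
      ∫⁻ z, ENNReal.ofReal (ω z) * ‖rep (T x) z‖ₑ ^ 2 ∂area := fun x _ => by
    rw [lintegral_weight_mul_enorm_sq_rep hω.weight, ENNReal.ofReal_pow (norm_nonneg _),
      ofReal_norm]
  rw [Finset.sum_congr rfl h3, ← lintegral_finsetSum' _ fun x _ =>
    aemeasurable_weight_mul_enorm_sq_rep hω.weight _]
  refine lintegral_mono_ae (ae_area_mem_disc.mono fun z hz => ?_)
  rw [← Finset.mul_sum]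
  gcongr
  have h4 : ∀ x ∈ s, ‖rep (T x) z‖ₑ ^ 2 = ENNReal.ofReal (‖inner ℂ x (κ z)‖ ^ 2) :=
    fun x _ => by
      rw [hT x z hz, ← ofReal_norm_sq]
      exact congrArg (fun t : ℝ => ENNReal.ofReal (t ^ 2)) (norm_inner_symm (𝕜 := ℂ) (κ z) x)
  rw [Finset.sum_congr rfl h4, ← ENNReal.ofReal_sum_of_nonneg fun x _ => sq_nonneg _,
    ← ofReal_norm, ← ENNReal.ofReal_pow (norm_nonneg _), ← Finset.sum_coe_sort]
  exact ENNReal.ofReal_le_ofReal (hs.sum_inner_products_le (κ z))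

/-- For κ(z) = K_{φ(z)} this is the identity C_φ* K_z = K_{φ(z)}. -/
theorem adjoint_kernel [CompleteSpace (bergmanSpace ω)]
    {K κ : ℂ → bergmanSpace ω}
    (hK : ∀ z ∈ disc, ∀ f, inner ℂ (K z) f = rep f z) {T : bergmanSpace ω →L[ℂ] bergmanSpace ω}
    (hT : ∀ f, ∀ z ∈ disc, rep (T f) z = inner ℂ (κ z) f) {z : ℂ} (hz : z ∈ disc) :
    adjoint T (K z) = κ z :=
  ext_inner_right ℂ fun f => by rw [adjoint_inner_left, hK z hz, hT f z hz]

/-- The Schatten class criterion for exponents at most `2`. -/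
theorem isSchatten_of_kernel (hω : IsDoubling ω) {K κ : ℂ → bergmanSpace ω}
    (hK : ∀ z ∈ disc, ∀ f, inner ℂ (K z) f = rep f z)
    (hfin : ∫⁻ z, ENNReal.ofReal (ω z) * ‖κ z‖ₑ ^ 2 ∂area < ⊤) {p : ℝ} (hp : 0 < p) (hp2 : p ≤ 2)
    (hfinp : ∫⁻ z, ENNReal.ofReal (ω z) * ENNReal.ofReal
      ((‖K z‖ ^ 2) ^ (1 - p / 2) * (‖κ z‖ ^ 2) ^ (p / 2)) ∂area < ⊤)
    {T : bergmanSpace ω →L[ℂ] bergmanSpace ω}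
    (hT : ∀ f, ∀ z ∈ disc, rep (T f) z = inner ℂ (κ z) f) : IsSchatten p T := by
  have := hω.completeSpace
  have hcomp := isCompactOperator_of_kernel hω hfin hT
  obtain ⟨ι, e, l, he, hl, heig, hsum⟩ := exists_spectral_family T hcomp
  refine ⟨hcomp, summable_singularValue_rpow he hsum hp (M := (∫⁻ z, ENNReal.ofReal (ω z) *
    ENNReal.ofReal ((‖K z‖ ^ 2) ^ (1 - p / 2) * (‖κ z‖ ^ 2) ^ (p / 2)) ∂area).toReal)
    fun F => ?_⟩
  have hnn : ∀ i, 0 ≤ l i ^ (p / 2) := fun i => Real.rpow_nonneg (hl i).le _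
  rw [← ENNReal.ofReal_le_iff_le_toReal hfinp.ne, ENNReal.ofReal_sum_of_nonneg fun i _ => hnn i]
  -- Each eigenvector has norm one, so the sum of eigenvalue powers becomes an integral and the
  -- estimate can be made pointwise in z.
  have h1 : ∀ i ∈ F, ENNReal.ofReal (l i ^ (p / 2)) = ∫⁻ z, ENNReal.ofReal (l i ^ (p / 2)) *
      (ENNReal.ofReal (ω z) * ‖rep (e i) z‖ₑ ^ 2) ∂area := by
    intro i _
    rw [lintegral_const_mul' _ _ ENNReal.ofReal_ne_top,
      lintegral_weight_mul_enorm_sq_rep hω.weight, ← ofReal_norm, he.1 i]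
    simp
  rw [Finset.sum_congr rfl h1, ← lintegral_finsetSum' _ fun i _ =>
    (aemeasurable_weight_mul_enorm_sq_rep hω.weight _).const_mul _]
  refine lintegral_mono_ae (ae_area_mem_disc.mono fun z hz => ?_)
  simp_rw [mul_left_comm _ (ENNReal.ofReal (ω z))]
  rw [← Finset.mul_sum]
  gcongr
  simp_rw [norm_rep_sq hK hz, ← ENNReal.ofReal_mul (hnn _)]
  rw [← ENNReal.ofReal_sum_of_nonneg fun i _ => mul_nonneg (hnn i) (sq_nonneg _)]
  refine ENNReal.ofReal_le_ofReal ?_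
  simp_rw [mul_comm (l _ ^ (p / 2))]
  refine (sum_mul_rpow_le F (fun i => sq_nonneg _) (fun i => (hl i).le) (by positivity)
    (by linarith)).trans ?_
  have hκ := hsum (K z)
  rw [adjoint_kernel hK hT hz] at hκ
  have h3 : ∑ i ∈ F, ‖inner ℂ (e i) (K z)‖ ^ 2 ≤ ‖K z‖ ^ 2 := he.sum_inner_products_le (K z)
  have h4 : ∑ i ∈ F, ‖inner ℂ (e i) (K z)‖ ^ 2 * l i ≤ ‖κ z‖ ^ 2 := by
    simp_rw [mul_comm _ (l _)]
    exact sum_le_hasSum F (fun i _ => mul_nonneg (hl i).le (sq_nonneg _)) hκ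
  have h5 : 0 ≤ ∑ i ∈ F, ‖inner ℂ (e i) (K z)‖ ^ 2 * l i :=
    Finset.sum_nonneg fun i _ => mul_nonneg (sq_nonneg _) (hl i).le
  have h6 : 0 ≤ 1 - p / 2 := by linarith
  gcongr

/-- The Schatten class criterion for exponents at least `2`. -/
theorem IsSchatten.exists_kernel_bound (hω : IsDoubling ω) {K κ : ℂ → bergmanSpace ω}
    (hK : ∀ z ∈ disc, ∀ f, inner ℂ (K z) f = rep f z) {p : ℝ} (hp2 : 2 ≤ p)
    {T : bergmanSpace ω →L[ℂ] bergmanSpace ω}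
    (hT : ∀ f, ∀ z ∈ disc, rep (T f) z = inner ℂ (κ z) f) (hS : IsSchatten p T) :
    ∃ W : ℂ → ℝ, ∫⁻ z, ENNReal.ofReal (ω z) * ENNReal.ofReal (W z) ∂area < ⊤ ∧
      ∀ z ∈ disc, 0 ≤ W z ∧ (‖κ z‖ ^ 2) ^ (p / 2) ≤ (‖K z‖ ^ 2) ^ (p / 2 - 1) * W z := by
  have := hω.completeSpace
  obtain ⟨ι, e, l, he, hl, heig, hsum⟩ := exists_spectral_family T hS.1
  have hnn : ∀ i, 0 ≤ l i ^ (p / 2) := fun i => Real.rpow_nonneg (hl i).le _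
  have hls : Summable fun i => l i ^ (p / 2) :=
    summable_of_sum_le hnn fun F => (sum_rpow_le_sum_singularValue he hl heig (by linarith) F).trans
      (hS.2.sum_le_tsum _ fun n _ => Real.rpow_nonneg (singularValue_nonneg T n) p)
  -- All terms are positive, so summability makes `ι` countable; this permits exchanging sum and
  -- integral.
  have hcount : Countable ι := by
    have h := hls.countable_support
    rwa [show Function.support (fun i => l i ^ (p / 2)) = univ from
      eq_univ_of_forall fun i => (Real.rpow_pos_of_pos (hl i) _).ne', countable_univ_iff] at h
  have hWs : ∀ z, Summable fun i => l i ^ (p / 2) * ‖inner ℂ (e i) (K z)‖ ^ 2 := by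
    intro z
    refine Summable.of_nonneg_of_le (fun i => mul_nonneg (hnn i) (sq_nonneg _)) (fun i => ?_)
      (hls.mul_right (‖K z‖ ^ 2))
    have := norm_inner_le_norm (𝕜 := ℂ) (e i) (K z)
    rw [he.1 i, one_mul] at this
    have := hnn i
    gcongr
  -- W(z) = Σ l_i^{p/2} |e_i(z)|² on the disc, whose integral against ω dA is Σ l_i^{p/2}.
  refine ⟨fun z => ∑' i, l i ^ (p / 2) * ‖inner ℂ (e i) (K z)‖ ^ 2, ?_, fun z hz =>
    ⟨tsum_nonneg fun i => mul_nonneg (hnn i) (sq_nonneg _), ?_⟩⟩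
  · have h1 : ∀ᵐ z ∂area, ENNReal.ofReal (ω z) * ENNReal.ofReal
        (∑' i, l i ^ (p / 2) * ‖inner ℂ (e i) (K z)‖ ^ 2) =
        ∑' i, ENNReal.ofReal (l i ^ (p / 2)) * (ENNReal.ofReal (ω z) * ‖rep (e i) z‖ₑ ^ 2) := by
      filter_upwards [ae_area_mem_disc] with z hz
      rw [ENNReal.ofReal_tsum_of_nonneg (fun i => mul_nonneg (hnn i) (sq_nonneg _)) (hWs z),
        ← ENNReal.tsum_mul_left]
      congr 1 with i
      rw [norm_rep_sq hK hz, ENNReal.ofReal_mul (hnn i), mul_left_comm]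
    rw [lintegral_congr_ae h1, lintegral_tsum fun i =>
      (aemeasurable_weight_mul_enorm_sq_rep hω.weight _).const_mul _]
    have h2 : ∀ i, ∫⁻ z, ENNReal.ofReal (l i ^ (p / 2)) * (ENNReal.ofReal (ω z) *
        ‖rep (e i) z‖ₑ ^ 2) ∂area = ENNReal.ofReal (l i ^ (p / 2)) := by
      intro i
      rw [lintegral_const_mul' _ _ ENNReal.ofReal_ne_top,
        lintegral_weight_mul_enorm_sq_rep hω.weight, ← ofReal_norm, he.1 i]
      simp
    simp_rw [h2]
    exact hls.tsum_ofReal_lt_top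
  · have hκ := hsum (K z)
    rw [adjoint_kernel hK hT hz] at hκ
    have hq : 1 ≤ p / 2 := by linarith
    have hlim : Tendsto (fun F : Finset ι => (∑ i ∈ F, ‖inner ℂ (e i) (K z)‖ ^ 2 * l i) ^ (p / 2))
        atTop (𝓝 ((‖κ z‖ ^ 2) ^ (p / 2))) := by
      simp_rw [mul_comm _ (l _)]
      exact (Real.continuous_rpow_const (by linarith)).continuousAt.tendsto.comp hκ
    refine le_of_tendsto' hlim fun F => ?_
    refine (rpow_sum_mul_le F (fun i => sq_nonneg _) (fun i => (hl i).le) hq).trans ?_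
    have h3 : ∑ i ∈ F, ‖inner ℂ (e i) (K z)‖ ^ 2 ≤ ‖K z‖ ^ 2 := he.sum_inner_products_le (K z)
    have h4 : ∑ i ∈ F, ‖inner ℂ (e i) (K z)‖ ^ 2 * l i ^ (p / 2) ≤
        ∑' i, l i ^ (p / 2) * ‖inner ℂ (e i) (K z)‖ ^ 2 := by
      simp_rw [mul_comm _ (l _ ^ (p / 2))]
      exact (hWs z).sum_le_tsum F fun i _ => mul_nonneg (hnn i) (sq_nonneg _)
    have h5 : 0 ≤ ∑ i ∈ F, ‖inner ℂ (e i) (K z)‖ ^ 2 * l i ^ (p / 2) :=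
      Finset.sum_nonneg fun i _ => mul_nonneg (sq_nonneg _) (hnn i)
    have h6 : 0 ≤ p / 2 - 1 := by linarith
    gcongr

end KernelOperators

end WeightedBergman

namespace WeightedBergman

open Filter Topology ContinuousLinearMap

/-! ### Comparison of the integrands and the two implications -/

section CompositionOperator

variable {ω : ℂ → ℝ} {φ : ℂ → ℂ}

theorem zero_mem_disc : (0 : ℂ) ∈ disc := by simp [disc]

theorem exists_norm_comp_le (hφ : DifferentiableOn ℂ φ disc) (hmaps : MapsTo φ disc disc) :
    ∃ ρ ∈ Ico (0 : ℝ) 1, ∀ z, ‖z‖ ≤ 1 / 2 → ‖φ z‖ ≤ ρ := by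
  obtain ⟨a, ha, h⟩ := exists_one_sub_norm_le hφ hmaps
  have ha2 : 0 < 1 / (2 * a) := by positivity
  refine ⟨max 0 (1 - 1 / (2 * a)), ⟨le_max_left _ _, max_lt one_pos (by linarith)⟩,
    fun z hz => le_max_of_le_right ?_⟩
  have h1 := h z (mem_disc.2 (by linarith))
  have h2 : 1 / (2 * a) ≤ 1 - ‖φ z‖ := by
    rw [div_le_iff₀ (by positivity)]
    linarith
  linarith

theorem IsDoubling.exists_le_star (hω : IsDoubling ω) {ρ : ℝ} (hρ : ρ ∈ Ico (0 : ℝ) 1) :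
    ∃ c > 0, ∀ w, ‖w‖ ≤ ρ → w ≠ 0 → c ≤ star ω w := by
  refine ⟨evalConst ω ρ / 2, half_pos (hω.evalConst_pos hρ), fun w hw h0 => ?_⟩
  have h1 := hω.le_star (mem_disc.2 (hw.trans_lt hρ.2)) h0
  have h2 := hω.evalConst_anti (norm_nonneg w) hw hρ.2.le
  rw [evalConst, evalConst] at h2
  rw [evalConst]
  linarith

theorem div_rpow_mul_div_eq {p x y a : ℝ} (hx : 0 < x) (hy : 0 < y) :
    (x / y) ^ (p / 2) * (a / x) = x ^ (p / 2 - 1) / y ^ (p / 2) * a := by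
  rw [Real.div_rpow hx.le hy.le, Real.rpow_sub_one hx.ne']
  ring

theorem div_rpow_div_eq {p x y : ℝ} (hx : 0 < x) (hy : 0 < y) :
    (x / y) ^ (p / 2) / x = (x⁻¹) ^ (1 - p / 2) * (y⁻¹) ^ (p / 2) := by
  rw [Real.div_rpow hx.le hy.le, Real.inv_rpow hx.le, Real.inv_rpow hy.le, Real.rpow_sub hx,
    Real.rpow_one]
  field_simp

/-- `W` accounts for |z| ≥ 1/2, where kernel norms and ω⋆ are interchangeable. The term 1/|z|
accounts for |z| ≤ 1/2, where φ(z) stays in a compact part of the disc and only the logarithmic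
growth of ω⋆(z) matters. -/
theorem exists_integrand_le (hω : IsDoubling ω) (hφ : DifferentiableOn ℂ φ disc)
    (hmaps : MapsTo φ disc disc) {K : ℂ → bergmanSpace ω}
    (hK : ∀ z ∈ disc, ∀ f, inner ℂ (K z) f = rep f z) {p : ℝ} (hp2 : 2 ≤ p) :
    ∃ C, 0 ≤ C ∧ ∀ z ∈ disc, ∀ W, 0 ≤ W →
      (‖K (φ z)‖ ^ 2) ^ (p / 2) ≤ (‖K z‖ ^ 2) ^ (p / 2 - 1) * W →
      (star ω z / star ω (φ z)) ^ (p / 2) * (ω z / star ω z) ≤ C * (W + ‖z‖⁻¹) * ω z := by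
  obtain ⟨c, hc, hlow⟩ := exists_le_kernel_norm_sq_mul_star hω hK
  obtain ⟨B, hB, hup⟩ := exists_kernel_norm_sq_mul_star_le hω hK
  obtain ⟨ρ, hρ, hφρ⟩ := exists_norm_comp_le hφ hmaps
  obtain ⟨c', hc', hlow'⟩ := hω.exists_le_star hρ
  set q := p / 2 - 1 with hq
  have hq0 : 0 ≤ q := by linarith
  have hp0 : 0 < p / 2 := by linarith
  set t := (tail ω 0).toReal with ht
  have ht0 : 0 ≤ t := ENNReal.toReal_nonneg
  refine ⟨B ^ q / c ^ (p / 2) + t ^ q * (q + 1) ^ q / c' ^ (p / 2), by positivity,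
    fun z hz W hW hKW => ?_⟩
  have hωz := hω.weight.nonneg z hz
  have hrhs : 0 ≤ (B ^ q / c ^ (p / 2) + t ^ q * (q + 1) ^ q / c' ^ (p / 2)) *
      (W + ‖z‖⁻¹) * ω z := by
    positivity
  rcases eq_or_ne z 0 with rfl | hz0
  · rw [star_zero, div_zero, mul_zero]
    exact hrhs
  -- Division by zero gives 0 here, the value that ω⋆(0) = +∞ would give.
  rcases eq_or_ne (φ z) 0 with hw0 | hw0
  · rw [hw0, star_zero, div_zero, Real.zero_rpow hp0.ne', zero_mul]
    exact hrhs
  have hs := hω.star_pos hz hz0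
  have hs' := hω.star_pos (hmaps hz) hw0
  rw [div_rpow_mul_div_eq hs hs', ← hq]
  refine mul_le_mul_of_nonneg_right ?_ hωz
  rw [add_mul]
  have hzi : 0 ≤ ‖z‖⁻¹ := by positivity
  rcases le_total (1 / 2) ‖z‖ with hz2 | hz2
  · have h1 : c ^ (p / 2) ≤ (‖K z‖ ^ 2) ^ q * W * star ω (φ z) ^ (p / 2) := by
      calc c ^ (p / 2) ≤ (‖K (φ z)‖ ^ 2 * star ω (φ z)) ^ (p / 2) := by
            have := hlow _ (hmaps hz) hw0
            gcongr
        _ = (‖K (φ z)‖ ^ 2) ^ (p / 2) * star ω (φ z) ^ (p / 2) :=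
            Real.mul_rpow (sq_nonneg _) hs'.le
        _ ≤ _ := by gcongr
    have h2 : (‖K z‖ ^ 2) ^ q * star ω z ^ q ≤ B ^ q := by
      rw [← Real.mul_rpow (sq_nonneg _) hs.le]
      have := hup z hz hz2
      gcongr
    have h3 : star ω z ^ q / star ω (φ z) ^ (p / 2) ≤ B ^ q / c ^ (p / 2) * W := by
      rw [div_mul_eq_mul_div, div_le_div_iff₀ (by positivity) (by positivity)]
      calc star ω z ^ q * c ^ (p / 2) ≤
          star ω z ^ q * ((‖K z‖ ^ 2) ^ q * W * star ω (φ z) ^ (p / 2)) := by gcongr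
        _ = ((‖K z‖ ^ 2) ^ q * star ω z ^ q) * W * star ω (φ z) ^ (p / 2) := by ring
        _ ≤ _ := by gcongr
    refine h3.trans ?_
    have h4 : B ^ q / c ^ (p / 2) * W ≤ B ^ q / c ^ (p / 2) * (W + ‖z‖⁻¹) := by
      gcongr
      linarith
    have h5 : 0 ≤ t ^ q * (q + 1) ^ q / c' ^ (p / 2) * (W + ‖z‖⁻¹) := by positivity
    linarith
  · have hz1 : 1 ≤ 1 / ‖z‖ := by
      rw [one_le_div (norm_pos_iff.2 hz0)]
      linarith
    have h1 : star ω z ^ q ≤ t ^ q * (q + 1) ^ q * ‖z‖⁻¹ := by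
      calc star ω z ^ q ≤ (Real.log (1 / ‖z‖) * t) ^ q := by
            have := hω.star_le_log hz hz0
            gcongr
        _ = t ^ q * Real.log (1 / ‖z‖) ^ q := by
            rw [Real.mul_rpow (Real.log_nonneg hz1) ht0, mul_comm]
        _ ≤ t ^ q * ((q + 1) ^ q * (1 / ‖z‖)) := by
            have := rpow_log_le hq0 hz1
            gcongr
        _ = _ := by ring
    have h2 : c' ^ (p / 2) ≤ star ω (φ z) ^ (p / 2) := by
      have := hlow' _ (hφρ z hz2) hw0
      gcongr
    have h3 : star ω z ^ q / star ω (φ z) ^ (p / 2) ≤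
        t ^ q * (q + 1) ^ q / c' ^ (p / 2) * ‖z‖⁻¹ := by
      rw [div_mul_eq_mul_div]
      gcongr
    refine h3.trans ?_
    have h4 : t ^ q * (q + 1) ^ q / c' ^ (p / 2) * ‖z‖⁻¹ ≤
        t ^ q * (q + 1) ^ q / c' ^ (p / 2) * (W + ‖z‖⁻¹) := by
      gcongr
      linarith
    have h5 : 0 ≤ B ^ q / c ^ (p / 2) * (W + ‖z‖⁻¹) := by positivity
    linarith

/-- The first bound feeds the Hilbert–Schmidt condition, the second the S_p criterion. The added 1
covers |z| ≤ 1/2, where all kernels involved are bounded. -/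
theorem exists_kernel_le_integrand (hω : IsDoubling ω) (hφ : DifferentiableOn ℂ φ disc)
    (hmaps : MapsTo φ disc disc) {K : ℂ → bergmanSpace ω}
    (hK : ∀ z ∈ disc, ∀ f, inner ℂ (K z) f = rep f z) {p : ℝ} (hp : 0 < p) (hp2 : p ≤ 2) :
    ∃ C, 0 ≤ C ∧ ∀ z ∈ disc,
      ‖K (φ z) - K 0‖ ^ 2 ≤ C * ((star ω z / star ω (φ z)) ^ (p / 2) / star ω z + 1) ∧
      (‖K z‖ ^ 2) ^ (1 - p / 2) * (‖K (φ z) - K 0‖ ^ 2) ^ (p / 2) ≤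
        C * ((star ω z / star ω (φ z)) ^ (p / 2) / star ω z + 1) := by
  obtain ⟨A, hA, hsub⟩ := exists_kernel_sub_norm_sq_mul_star_le hω hK
  obtain ⟨B, hB, hup⟩ := exists_kernel_norm_sq_mul_star_le hω hK
  obtain ⟨E, hE, hcomp⟩ := hω.exists_star_le_star_comp hφ hmaps
  obtain ⟨ρ, hρ, hφρ⟩ := exists_norm_comp_le hφ hmaps
  obtain ⟨M, hM, hMρ⟩ := exists_kernel_norm_sq_le hω hK (ρ := max ρ (1 / 2))
    ⟨le_max_of_le_left hρ.1, max_lt hρ.2 (by norm_num)⟩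
  have hq0 : 0 ≤ 1 - p / 2 := by linarith
  have hp0 : 0 < p / 2 := by linarith
  refine ⟨4 * M + A * E ^ (1 - p / 2) + B ^ (1 - p / 2) * A ^ (p / 2), by positivity,
    fun z hz => ?_⟩
  set J := (star ω z / star ω (φ z)) ^ (p / 2) / star ω z with hJ
  have hs0 := hω.star_nonneg hz
  have hs0' := hω.star_nonneg (hmaps hz)
  have hJ0 : 0 ≤ J := by positivity
  have hC1 : 0 ≤ A * E ^ (1 - p / 2) := by positivity
  have hC2 : 0 ≤ B ^ (1 - p / 2) * A ^ (p / 2) := by positivity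
  have hle : ∀ {x y : ℝ}, x ≤ y → y ≤ 4 * M + A * E ^ (1 - p / 2) + B ^ (1 - p / 2) * A ^ (p / 2) →
      x ≤ (4 * M + A * E ^ (1 - p / 2) + B ^ (1 - p / 2) * A ^ (p / 2)) * (J + 1) := by
    intro x y h1 h2
    have : 0 ≤ (4 * M + A * E ^ (1 - p / 2) + B ^ (1 - p / 2) * A ^ (p / 2)) * J := by positivity
    linarith
  have hle' : ∀ {x y : ℝ}, x ≤ y * J →
      y ≤ 4 * M + A * E ^ (1 - p / 2) + B ^ (1 - p / 2) * A ^ (p / 2) →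
      x ≤ (4 * M + A * E ^ (1 - p / 2) + B ^ (1 - p / 2) * A ^ (p / 2)) * (J + 1) := by
    intro x y h1 h2
    have := mul_le_mul_of_nonneg_right h2 hJ0
    linarith
  rcases le_total ‖z‖ (1 / 2) with hz2 | hz2
  · have h1 : ‖K (φ z) - K 0‖ ^ 2 ≤ 4 * M := by
      have h2 := hMρ (φ z) ((hφρ z hz2).trans (le_max_left _ _))
      have h3 := hMρ 0 (by rw [norm_zero]; exact le_max_of_le_left hρ.1)
      have h4 := pow_le_pow_left₀ (norm_nonneg _) (norm_sub_le (K (φ z)) (K 0)) 2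
      nlinarith [sq_nonneg (‖K (φ z)‖ - ‖K 0‖)]
    have h2 : ‖K z‖ ^ 2 ≤ 4 * M := (hMρ z (hz2.trans (le_max_right _ _))).trans (by linarith)
    refine ⟨hle h1 (by linarith), hle (y := 4 * M) ?_ (by linarith)⟩
    calc _ ≤ (4 * M) ^ (1 - p / 2) * (4 * M) ^ (p / 2) := by gcongr
      _ = 4 * M := by rw [← Real.rpow_add (by positivity), sub_add_cancel, Real.rpow_one]
  -- The right side has no singular term when φ(z) = 0; subtracting K_0 makes the left side vanish
  -- there as well.
  rcases eq_or_ne (φ z) 0 with hw0 | hw0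
  · rw [hw0, sub_self, norm_zero, zero_pow two_ne_zero, Real.zero_rpow hp0.ne', mul_zero]
    exact ⟨by positivity, by positivity⟩
  have hz0 : z ≠ 0 := by rintro rfl; norm_num at hz2
  have hs := hω.star_pos hz hz0
  have hs' := hω.star_pos (hmaps hz) hw0
  have h1 : ‖K (φ z) - K 0‖ ^ 2 ≤ A * (star ω (φ z))⁻¹ := by
    rw [← div_eq_mul_inv, le_div_iff₀ hs']
    exact hsub _ (hmaps hz)
  have h2 : ‖K z‖ ^ 2 ≤ B * (star ω z)⁻¹ := by
    rw [← div_eq_mul_inv, le_div_iff₀ hs]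
    exact hup z hz hz2
  have h3 : (star ω (φ z))⁻¹ ≤ E * (star ω z)⁻¹ := by
    rw [← div_eq_mul_inv, le_div_iff₀ hs, inv_mul_le_iff₀ hs', mul_comm]
    exact hcomp z hz hz2 hw0
  have hJe := div_rpow_div_eq (p := p) hs hs'
  rw [← hJ] at hJe
  have hi : 0 < (star ω z)⁻¹ := inv_pos.2 hs
  have hi' : 0 < (star ω (φ z))⁻¹ := inv_pos.2 hs'
  refine ⟨hle' (y := A * E ^ (1 - p / 2)) ?_ (by linarith),
    hle' (y := B ^ (1 - p / 2) * A ^ (p / 2)) ?_ (by linarith)⟩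
  · calc ‖K (φ z) - K 0‖ ^ 2 ≤ A * (star ω (φ z))⁻¹ := h1
      -- The power 1 - p/2 ≥ 0 of 1/ω⋆(φ(z)) is traded for that of E/ω⋆(z) by Schwarz–Pick, which
      -- produces the integrand of (*) without its factor ω.
      _ = A * ((star ω (φ z))⁻¹ ^ (1 - p / 2) * (star ω (φ z))⁻¹ ^ (p / 2)) := by
          rw [← Real.rpow_add hi', sub_add_cancel, Real.rpow_one]
      _ ≤ A * ((E * (star ω z)⁻¹) ^ (1 - p / 2) * (star ω (φ z))⁻¹ ^ (p / 2)) := by gcongr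
      _ = A * E ^ (1 - p / 2) * J := by
          rw [Real.mul_rpow hE.le hi.le, hJe]
          ring
  · calc _ ≤ (B * (star ω z)⁻¹) ^ (1 - p / 2) * (A * (star ω (φ z))⁻¹) ^ (p / 2) := by gcongr
      _ = B ^ (1 - p / 2) * A ^ (p / 2) * J := by
          rw [Real.mul_rpow hB.le hi.le, Real.mul_rpow hA.le hi'.le, hJe]
          ring

theorem lintegral_lt_top_of_le_integrand (hω : IsDoubling ω) (hmaps : MapsTo φ disc disc) {p C : ℝ}
    (hC : 0 ≤ C) (hint : compositionIntegral p ω φ < ⊤) {g : ℂ → ℝ}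
    (hg : ∀ z ∈ disc, g z ≤ C * ((star ω z / star ω (φ z)) ^ (p / 2) / star ω z + 1)) :
    ∫⁻ z, ENNReal.ofReal (ω z) * ENNReal.ofReal (g z) ∂area < ⊤ := by
  have h1 : ∫⁻ z, ENNReal.ofReal (ω z) ∂area < ⊤ := hω.weight.integrable.lintegral_lt_top
  calc _ ≤ ∫⁻ z, ENNReal.ofReal C * (ENNReal.ofReal ((star ω z / star ω (φ z)) ^ (p / 2) *
        (ω z / star ω z)) + ENNReal.ofReal (ω z)) ∂area := by
        refine lintegral_mono_ae (ae_area_mem_disc.mono fun z hz => ?_)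
        have hωz := hω.weight.nonneg z hz
        have hs := hω.star_nonneg hz
        have hs' := hω.star_nonneg (hmaps hz)
        rw [← ENNReal.ofReal_mul hωz, ← ENNReal.ofReal_add (by positivity) hωz,
          ← ENNReal.ofReal_mul hC]
        refine ENNReal.ofReal_le_ofReal ?_
        refine (mul_le_mul_of_nonneg_left (hg z hz) hωz).trans_eq ?_
        ring
    _ = ENNReal.ofReal C * (compositionIntegral p ω φ + ∫⁻ z, ENNReal.ofReal (ω z) ∂area) := by
        rw [lintegral_const_mul' _ _ ENNReal.ofReal_ne_top,
          lintegral_add_right' _ hω.weight.aemeasurable_ofReal]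
        rfl
    _ < ⊤ := by finiteness

theorem isCompositionOperator_of_rep (hω : IsDoubling ω) (hmaps : MapsTo φ disc disc)
    {T : bergmanSpace ω →L[ℂ] bergmanSpace ω}
    (hT : ∀ f, ∀ z ∈ disc, rep (T f) z = rep f (φ z)) : IsCompositionOperator ω φ T := by
  intro f F hF hfF
  filter_upwards [coe_ae_eq_rep (T f), ae_weightedArea_mem_disc] with z h1 hz
  rw [h1, hT f z hz, Function.comp_apply, hω.rep_eq hF hfF (hmaps hz)]

theorem IsCompositionOperator.rep_apply (hω : IsDoubling ω) (hφ : DifferentiableOn ℂ φ disc)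
    (hmaps : MapsTo φ disc disc) {T : bergmanSpace ω →L[ℂ] bergmanSpace ω}
    (hT : IsCompositionOperator ω φ T) (f : bergmanSpace ω) {z : ℂ} (hz : z ∈ disc) :
    rep (T f) z = rep f (φ z) :=
  hω.rep_eq ((rep_differentiableOn f).comp hφ hmaps)
    (hT f (rep f) (rep_differentiableOn f) (coe_ae_eq_rep f)) hz

/-- The decomposition f∘φ = (f∘φ - f(0)) + f(0)·1 writes `C_φ` as the operator T with vectors
K_{φ(z)} - K_0 plus the rank one operator R = ⟪K_0, ·⟫ 1. -/
theorem compositionSchatten_of_le_two (hω : IsDoubling ω) (hφ : DifferentiableOn ℂ φ disc)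
    (hmaps : MapsTo φ disc disc) {p : ℝ} (hp : 0 < p) (hp2 : p ≤ 2)
    (hint : compositionIntegral p ω φ < ⊤) : CompositionSchatten p ω φ := by
  obtain ⟨K, hK⟩ := hω.exists_kernel
  obtain ⟨C, hC, hbd⟩ := exists_kernel_le_integrand hω hφ hmaps hK hp hp2
  have hfin : ∫⁻ z, ENNReal.ofReal (ω z) * ‖K (φ z) - K 0‖ₑ ^ 2 ∂area < ⊤ := by
    have h := lintegral_lt_top_of_le_integrand hω hmaps hC hint fun z hz => (hbd z hz).1
    simp_rw [ENNReal.ofReal_pow (norm_nonneg _), ofReal_norm] at h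
    exact h
  have hfinp := lintegral_lt_top_of_le_integrand hω hmaps hC hint fun z hz => (hbd z hz).2
  have hdiff : ∀ f, DifferentiableOn ℂ (fun z => inner ℂ (K (φ z) - K 0) f) disc := by
    intro f
    refine (((rep_differentiableOn f).comp hφ hmaps).sub_const (rep f 0)).congr fun z hz => ?_
    rw [inner_sub_left, hK _ (hmaps hz), hK _ zero_mem_disc, Function.comp_apply]
  obtain ⟨T, hT⟩ := exists_operator_of_kernel hω hdiff hfin
  have hS : IsSchatten p T := isSchatten_of_kernel hω hK hfin hp hp2 hfinp hT
  have := hω.isFiniteMeasure_weightedArea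
  obtain ⟨u, hu⟩ := exists_bergmanSpace_of_lintegral_lt_top (ω := ω) (F := fun _ => 1)
    (differentiableOn_const 1) (by simp)
  set R : bergmanSpace ω →L[ℂ] bergmanSpace ω := (innerSL ℂ (K 0)).smulRight u with hR
  have hrank : LinearMap.rank (R : bergmanSpace ω →ₗ[ℂ] bergmanSpace ω) ≤ 1 := by
    refine (Submodule.rank_mono (t := Submodule.span ℂ {u}) ?_).trans ?_
    · rintro _ ⟨f, rfl⟩
      exact Submodule.smul_mem _ _ (Submodule.mem_span_singleton_self u)
    · simpa using rank_span_le (R := ℂ) ({u} : Set (bergmanSpace ω))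
  refine ⟨T + R, isCompositionOperator_of_rep hω hmaps fun f z hz => ?_,
    hS.add_of_rank_le_one hp hrank⟩
  have h1 : (T + R) f = T f + rep f 0 • u := by
    rw [← hK 0 zero_mem_disc]
    rfl
  rw [h1, hω.rep_add _ _ hz, hω.rep_smul _ _ hz, hω.rep_eq (differentiableOn_const 1) hu hz,
    hT f z hz, inner_sub_left, hK _ (hmaps hz), hK _ zero_mem_disc]
  ring

/-- No subtraction of K_0 is needed in this direction: the lower bound for ‖K_w‖² ω⋆(w) holds for
every w ≠ 0. -/
theorem CompositionSchatten.compositionIntegral_lt_top (hω : IsDoubling ω)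
    (hφ : DifferentiableOn ℂ φ disc) (hmaps : MapsTo φ disc disc) {p : ℝ} (hp2 : 2 ≤ p)
    (h : CompositionSchatten p ω φ) : compositionIntegral p ω φ < ⊤ := by
  obtain ⟨T, hT, hS⟩ := h
  obtain ⟨K, hK⟩ := hω.exists_kernel
  obtain ⟨W, hWint, hW⟩ := hS.exists_kernel_bound hω hK (κ := fun z => K (φ z)) hp2
    fun f z hz => by rw [hT.rep_apply hω hφ hmaps f hz, hK _ (hmaps hz)]
  obtain ⟨C, hC, hbd⟩ := exists_integrand_le hω hφ hmaps hK hp2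
  have hinv := hω.lintegral_inv_norm_lt_top
  have hmeas : AEMeasurable (fun z : ℂ => ENNReal.ofReal ‖z‖⁻¹) area := by fun_prop
  rw [lintegral_weightedArea hω.weight hmeas] at hinv
  calc compositionIntegral p ω φ ≤ ∫⁻ z, ENNReal.ofReal C * (ENNReal.ofReal (ω z) *
        ENNReal.ofReal (W z) + ENNReal.ofReal (ω z) * ENNReal.ofReal ‖z‖⁻¹) ∂area := by
        refine lintegral_mono_ae (ae_area_mem_disc.mono fun z hz => ?_)
        have hωz := hω.weight.nonneg z hz
        obtain ⟨hW0, hKW⟩ := hW z hz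
        rw [← mul_add, ← ENNReal.ofReal_add hW0 (by positivity), ← ENNReal.ofReal_mul hωz,
          ← ENNReal.ofReal_mul hC]
        refine ENNReal.ofReal_le_ofReal ((hbd z hz (W z) hW0 hKW).trans_eq ?_)
        ring
    _ = ENNReal.ofReal C * (∫⁻ z, ENNReal.ofReal (ω z) * ENNReal.ofReal (W z) ∂area +
          ∫⁻ z, ENNReal.ofReal (ω z) * ENNReal.ofReal ‖z‖⁻¹ ∂area) := by
        rw [lintegral_const_mul' _ _ ENNReal.ofReal_ne_top,
          lintegral_add_right' (g := fun z => ENNReal.ofReal (ω z) * ENNReal.ofReal ‖z‖⁻¹) _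
            (hω.weight.aemeasurable_ofReal.mul hmeas)]
    _ < ⊤ := by finiteness

end CompositionOperator

end WeightedBergman

theorem mainTheorem8 (p : ℝ) (hp : 0 < p) (ω : ℂ → ℝ) (hω : WeightedBergman.IsDoubling ω)
    (φ : ℂ → ℂ) (hφ : DifferentiableOn ℂ φ WeightedBergman.disc)
    (hmaps : Set.MapsTo φ WeightedBergman.disc WeightedBergman.disc) :
    (p ≤ 2 → WeightedBergman.compositionIntegral p ω φ < ⊤ →
      WeightedBergman.CompositionSchatten p ω φ) ∧
    (2 ≤ p → WeightedBergman.CompositionSchatten p ω φ →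
      WeightedBergman.compositionIntegral p ω φ < ⊤) :=
  ⟨fun hp2 hint => WeightedBergman.compositionSchatten_of_le_two hω hφ hmaps hp hp2 hint,
    fun hp2 h => h.compositionIntegral_lt_top hω hφ hmaps hp2⟩
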